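/- A beer graph is an undirected graph $G=(V,E)$ in which each edge $e$ has a weight $\omega(e)>0$ and a subset $B\subseteq V$ of the vertices is marked as beer stores. A beer path from $u$ to $v$ is a (possibly non-simple) path from $u$ to $v$ that visits at least one vertex of $B$; $\mathsf{dist}(u,v)$ is the minimum weight of a path from $u$ to $v$, and $\mathsf{dist}_B(u,v)$ is the minimum weight of a beer path from $u$ to $v$ ($\infty$ if there is none). The graph $G$ is maximal outerplanar if it is outerplanar (it has a plane drawing without crossings in which all vertices lie on the outer face) and adding an edge between any two non-adjacent vertices gives a graph that is not outerplanar. It satisfies the generalized triangle inequality if $\mathsf{dist}(u,v)=\omega(u,v)$ for every edge $(u,v)$. There is an algorithm (in the RAM model, where real edge weights are only added and compared, at unit cost) which, given a maximal outerplanar beer graph $G$ with $n$ vertices that satisfies the generalized triangle inequality, as a list of its weighted edges in arbitrary order together with the marks of the beer stores, and given a source vertex $s$, computes $\mathsf{dist}_B(s,v)$ for all vertices $v$ of $G$ in $O(n)$ total time. Moreover, if $B\neq\emptyset$, then after this $O(n)$-time computation, for any query vertex $v$, and for any number of queries one after the other, a shortest beer path $\mathsf{SP}_B(s,v)$ from $s$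 to $v$ can be reported, as the sequence of its vertices, in $O(L)$ time, where $L$ is the number of vertices on the reported path. The constants in $O(n)$ and $O(L)$ are absolute. -/

import Mathlib

namespace Beer

/-! ### Outerplanar graphs -/

section Graphs

variable {V : Type*}

/-- `G` is outerplanar: it can be drawn in the plane without crossings and with all vertices on the
outer face.  As usual the drawing is taken with the vertices on the unit circle (so that the outside
of the circle belongs to the outer face and touches every vertex) and with the edges as straight
segments; no two distinct edges meet except possibly at a common end vertex. -/
def IsOuterplanar (G : SimpleGraph V) : Prop :=
  ∃ pos : V → ℂ, Function.Injective pos ∧ (∀ v, ‖pos v‖ = 1) ∧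
    ∀ a b c d : V, G.Adj a b → G.Adj c d → s(a, b) ≠ s(c, d) →
      Disjoint (openSegment ℝ (pos a) (pos b)) (openSegment ℝ (pos c) (pos d))

/-- `G` is outerplanar, and adding an edge between any two distinct non-adjacent vertices
gives a graph that is not outerplanar. -/
def IsMaximalOuterplanar (G : SimpleGraph V) : Prop :=
  IsOuterplanar G ∧
    ∀ u v : V, u ≠ v → ¬ G.Adj u v → ¬ IsOuterplanar (G ⊔ SimpleGraph.edge u v)

/-! ### Distances and beer distances -/

/-- The weight of a (possibly non-simple) path: the sum of the weights of the edges it traverses,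
with multiplicity. -/
def weight {G : SimpleGraph V} (ω : Sym2 V → ℝ) {u v : V} (p : G.Walk u v) : ℝ :=
  (p.edges.map ω).sum

/-- The distance between `u` and `v` (`⊤` if they are not connected). -/
noncomputable def dist (G : SimpleGraph V) (ω : Sym2 V → ℝ) (u v : V) : EReal :=
  ⨅ p : G.Walk u v, (weight ω p : EReal)

/-- A beer path is a possibly non-simple path that visits at least one beer store. -/
def IsBeerPath {G : SimpleGraph V} (B : Finset V) {u v : V} (p : G.Walk u v) : Prop :=
  ∃ b ∈ B, b ∈ p.support

/-- The beer distance between `u` and `v` (`⊤` if there is no beer path between them). -/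
noncomputable def beerDist (G : SimpleGraph V) (ω : Sym2 V → ℝ) (B : Finset V) (u v : V) : EReal :=
  ⨅ p : {p : G.Walk u v // IsBeerPath B p}, (weight ω p.1 : EReal)

/-- `p` is a shortest beer path between its end vertices. -/
def IsShortestBeerPath {G : SimpleGraph V} (ω : Sym2 V → ℝ) (B : Finset V) {u v : V}
    (p : G.Walk u v) : Prop :=
  IsBeerPath B p ∧ ∀ q : G.Walk u v, IsBeerPath B q → weight ω p ≤ weight ω q

/-- The generalized triangle inequality: every edge is a shortest path between its ends. -/
def GeneralizedTriangleInequality (G : SimpleGraph V) (ω : Sym2 V → ℝ) : Prop :=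
  ∀ u v : V, G.Adj u v → dist G ω u v = (ω s(u, v) : EReal)

/-- `l` lists every edge of `G` exactly once, in arbitrary order and in arbitrary orientation. -/
def IsEdgeList (G : SimpleGraph V) (l : List (V × V)) : Prop :=
  (l.map fun e => s(e.1, e.2)).Nodup ∧
    ∀ e : Sym2 V, e ∈ l.map (fun e => s(e.1, e.2)) ↔ e ∈ G.edgeSet

end Graphs

/-! ### A random access machine with real numbers

The machine has integer registers, integer arrays and real arrays, each kind numbered by constants
of the program (so that a program uses finitely many of them), and a write-only output list.
Arrays have random access.  The only arithmetic is successor and predecessor on natural numbers and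
addition on reals; both kinds of numbers can be compared.  In particular, all integers that occur
within `t` steps exceed the constants of the program and the input integers by at most `t`, hence
fit into words of `O(log n)` bits when `t = O(n)`, and the reals are used in the
comparison-addition model. -/

/-- The contents of the memory. -/
structure Memory where
  /-- integer registers -/
  reg : ℕ → ℕ
  /-- integer arrays: `nat k i` is cell `i` of array `k` -/
  nat : ℕ → ℕ → ℕ
  /-- real arrays: `real k i` is cell `i` of array `k` -/
  real : ℕ → ℕ → ℝ
  /-- the output written so far, first item first -/
  out : List ℕ

/-- Integer expressions. -/
inductive NExp where
  | const (k : ℕ)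
  | reg (k : ℕ)
  | cell (k : ℕ) (i : NExp)
  | succ (e : NExp)
  | pred (e : NExp)

/-- Real expressions. -/
inductive RExp where
  | zero
  | cell (k : ℕ) (i : NExp)
  | plus (a b : RExp)

/-- Tests. -/
inductive Test where
  | natEq (a b : NExp)
  | natLt (a b : NExp)
  | realLt (a b : RExp)
  | neg (b : Test)
  | conj (a b : Test)

/-- Programs. -/
inductive Program where
  | skip
  | setReg (k : ℕ) (e : NExp)
  | setNat (k : ℕ) (i e : NExp)
  | setReal (k : ℕ) (i : NExp) (e : RExp)
  | emit (e : NExp)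
  | seq (c d : Program)
  | branch (b : Test) (c d : Program)
  | loop (b : Test) (c : Program)

/-- The value of an integer expression. -/
def NExp.eval (m : Memory) : NExp → ℕ
  | .const k => k
  | .reg k => m.reg k
  | .cell k i => m.nat k (i.eval m)
  | .succ e => e.eval m + 1
  | .pred e => e.eval m - 1

/-- The number of elementary operations in evaluating an integer expression. -/
def NExp.cost : NExp → ℕ
  | .const _ => 1
  | .reg _ => 1
  | .cell _ i => i.cost + 1
  | .succ e => e.cost + 1
  | .pred e => e.cost + 1

/-- The value of a real expression. -/
def RExp.eval (m : Memory) : RExp → ℝ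
  | .zero => 0
  | .cell k i => m.real k (i.eval m)
  | .plus a b => a.eval m + b.eval m

/-- The number of elementary operations in evaluating a real expression. -/
def RExp.cost : RExp → ℕ
  | .zero => 1
  | .cell _ i => i.cost + 1
  | .plus a b => a.cost + b.cost + 1

/-- The truth value of a test. -/
def Test.Holds (m : Memory) : Test → Prop
  | .natEq a b => a.eval m = b.eval m
  | .natLt a b => a.eval m < b.eval m
  | .realLt a b => a.eval m < b.eval m
  | .neg b => ¬ b.Holds m
  | .conj a b => a.Holds m ∧ b.Holds m

/-- The number of elementary operations in evaluating a test. -/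
def Test.cost : Test → ℕ
  | .natEq a b => a.cost + b.cost + 1
  | .natLt a b => a.cost + b.cost + 1
  | .realLt a b => a.cost + b.cost + 1
  | .neg b => b.cost + 1
  | .conj a b => a.cost + b.cost + 1

/-- Assignment to an integer register. -/
def Memory.setReg (m : Memory) (k x : ℕ) : Memory :=
  { m with reg := Function.update m.reg k x }

/-- Assignment to a cell of an integer array. -/
def Memory.setNat (m : Memory) (k i x : ℕ) : Memory :=
  { m with nat := Function.update m.nat k (Function.update (m.nat k) i x) }

/-- Assignment to a cell of a real array. -/
noncomputable def Memory.setReal (m : Memory) (k i : ℕ) (x : ℝ) : Memory :=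
  { m with real := Function.update m.real k (Function.update (m.real k) i x) }

/-- Appending an item to the output. -/
def Memory.emit (m : Memory) (x : ℕ) : Memory :=
  { m with out := m.out ++ [x] }

/-- `Exec c m t m'`: the program `c`, started with memory `m`, terminates after `t` elementary
steps with memory `m'`. -/
inductive Exec : Program → Memory → ℕ → Memory → Prop where
  | skip (m : Memory) : Exec .skip m 1 m
  | setReg (m : Memory) (k : ℕ) (e : NExp) :
      Exec (.setReg k e) m (e.cost + 1) (m.setReg k (e.eval m))
  | setNat (m : Memory) (k : ℕ) (i e : NExp) :
      Exec (.setNat k i e) m (i.cost + e.cost + 1) (m.setNat k (i.eval m) (e.eval m))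
  | setReal (m : Memory) (k : ℕ) (i : NExp) (e : RExp) :
      Exec (.setReal k i e) m (i.cost + e.cost + 1) (m.setReal k (i.eval m) (e.eval m))
  | emit (m : Memory) (e : NExp) :
      Exec (.emit e) m (e.cost + 1) (m.emit (e.eval m))
  | seq {c d : Program} {m m₁ m₂ : Memory} {t₁ t₂ : ℕ} :
      Exec c m t₁ m₁ → Exec d m₁ t₂ m₂ → Exec (.seq c d) m (t₁ + t₂) m₂
  | branchTrue {b : Test} {c d : Program} {m m₁ : Memory} {t : ℕ} :
      b.Holds m → Exec c m t m₁ → Exec (.branch b c d) m (b.cost + t) m₁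
  | branchFalse {b : Test} {c d : Program} {m m₁ : Memory} {t : ℕ} :
      ¬ b.Holds m → Exec d m t m₁ → Exec (.branch b c d) m (b.cost + t) m₁
  | loopTrue {b : Test} {c : Program} {m m₁ m₂ : Memory} {t₁ t₂ : ℕ} :
      b.Holds m → Exec c m t₁ m₁ → Exec (.loop b c) m₁ t₂ m₂ →
        Exec (.loop b c) m (b.cost + t₁ + t₂) m₂
  | loopFalse {b : Test} {c : Program} {m : Memory} :
      ¬ b.Holds m → Exec (.loop b c) m b.cost m

/-! ### Input and output conventions -/

/-- The initial memory for a beer graph with vertices `0, …, n - 1`, given by its list of edges.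
Registers `0, 1, 2` hold the number of vertices, the number of edges and the source; integer arrays
`0` and `1` hold the end vertices of the edges, and real array `0` their weights; integer array `2`
marks the beer stores.  Everything else is zero. -/
def inputMemory {n : ℕ} (ω : Sym2 (Fin n) → ℝ) (B : Finset (Fin n)) (s : Fin n)
    (l : List (Fin n × Fin n)) : Memory where
  reg k := match k with
    | 0 => n
    | 1 => l.length
    | 2 => s
    | _ => 0
  nat k i := match k with
    | 0 => (l[i]?.map fun e => (e.1 : ℕ)).getD 0
    | 1 => (l[i]?.map fun e => (e.2 : ℕ)).getD 0
    | 2 => if i ∈ B.image Fin.val then 1 else 0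
    | _ => 0
  real k i := match k with
    | 0 => (l[i]?.map fun e => ω s(e.1, e.2)).getD 0
    | _ => 0
  out := []

/-- The extended real number that the memory holds for vertex `v` after the distance computation:
`∞` if cell `v` of integer array `3` is zero, and cell `v` of real array `1` otherwise. -/
noncomputable def Memory.result (m : Memory) (v : ℕ) : EReal :=
  if m.nat 3 v = 0 then ⊤ else (m.real 1 v : EReal)

/-- The memory when a query for vertex `v` is asked: `v` is put into register `3`, and the output
list is emptied. -/
def Memory.ask (m : Memory) (v : ℕ) : Memory :=
  { m.setReg 3 v with out := [] }

/-- `AfterQueries query n m m'`: the memory `m` turns into `m'` by answering some finite sequence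
(possibly empty) of queries for vertices among `0, …, n - 1`, one after the other. -/
def AfterQueries (query : Program) (n : ℕ) : Memory → Memory → Prop :=
  Relation.ReflTransGen fun m m' => ∃ v < n, ∃ t, Exec query (m.ask v) t m'

end Beer

/-!
In a maximal outerplanar graph, drawn on the circle, no two edges cross and every missing edge would
cross some edge (`exists_order_of_isMaximalOuterplanar`).  Both properties persist when a vertex of
degree at most two is removed (`Saturated.erase`), the remaining neighbours of such a vertex are
adjacent (`Saturated.adj_of_degree_le_two`), and a noncrossing graph always has such a vertex
(`NonCrossing.exists_degree_le_two`).  So peeling off vertices of degree at most two, which a queue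
does in linear time (`runs_peel`), removes all vertices and yields a perfect elimination order.  It
also shows that there are at most `2 * n` edges.

Given a perfect elimination order and the generalized triangle inequality, the values
`min_x (f x + dist x v)` are computed for any initial values `f` by a single sweep: along the order
every vertex relaxes its edges to its neighbours, and in the reverse order every vertex relaxes the
edges from its neighbours.  Indeed a detour through a removed vertex is never shorter than the edge
between its two remaining neighbours (`relaxAll_orderedSweepEdges_le`); the relaxations between a
vertex and its earlier neighbours, which the sweep also performs, do no harm
(`relaxAll_le_of_sublist`).

The beer distance of `v` is the minimum of `dist s b + dist b v` over the beer stores `b`.  Two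
sweeps therefore suffice: one from `s` gives the distances, and one that starts at the beer stores,
with these distances as initial values, gives the beer distances (`isMinWeight_sweep_source`,
`isMinWeight_sweep_beer`).

Finally every vertex records a neighbour through which its distance is attained, and one through
which its beer distance is attained (`runs_recordPreds`).  A query follows the latter back to a beer
store whose distance and beer distance agree, and the former from there back to the source
(`exists_runs_traceBeer`, `exists_runs_tracePlain`).  As the weights are positive, the values drop
in every step, so this terminates, in time proportional to the length of the path.

Besides the input, the memory is used as follows.  Integer arrays: `3` and `9` flags of finiteness
of beer distances and distances, `4` first darts of the vertices, `5` ends of the darts, `6` next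
darts, `7` degrees, `8` elimination order, `10` and `11` predecessors on paths and on beer paths,
`12` stack.
Real arrays: `1` beer distances, `2` weights of the darts, `3` distances.
-/

namespace Beer

/-! ### Chords of the unit circle -/

/-- Twice the signed area of the triangle with corners `a`, `b`, `c`. -/
def orient (a b c : ℂ) : ℝ :=
  (b.re - a.re) * (c.im - a.im) - (b.im - a.im) * (c.re - a.re)

lemma orient_rotate (a b c : ℂ) : orient b c a = orient a b c := by
  simp only [orient]; ring

lemma orient_swap (a b c : ℂ) : orient a c b = -orient a b c := by
  simp only [orient]; ring

/-- Points of the unit circle in the order of their arguments form a positively oriented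
triangle. -/
lemma orient_pos_of_arg_lt {a b c : ℂ} (ha : ‖a‖ = 1) (hb : ‖b‖ = 1) (hc : ‖c‖ = 1)
    (hab : a.arg < b.arg) (hbc : b.arg < c.arg) : 0 < orient a b c := by
  have key : ∀ z : ℂ, ‖z‖ = 1 → z.re = Real.cos z.arg ∧ z.im = Real.sin z.arg := by
    intro z hz
    have hz0 : z ≠ 0 := by
      rintro rfl
      simp at hz
    rw [Complex.cos_arg hz0, Complex.sin_arg, hz]
    simp
  have hpa := Complex.neg_pi_lt_arg a
  have hpc := Complex.arg_le_pi c
  set α := a.arg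
  set β := b.arg
  set γ := c.arg
  -- the signed area of a triangle inscribed in the unit circle in terms of its half angles
  have formula : orient a b c
      = 4 * Real.sin ((β - α) / 2) * Real.sin ((γ - β) / 2) * Real.sin ((γ - α) / 2) := by
    have h1 : orient a b c = Real.sin (γ - β) - Real.sin (γ - α) + Real.sin (β - α) := by
      simp only [orient, (key a ha).1, (key a ha).2, (key b hb).1, (key b hb).2, (key c hc).1,
        (key c hc).2, Real.sin_sub]
      ring
    obtain ⟨p, hp⟩ : ∃ p, p = (β - α) / 2 := ⟨_, rfl⟩
    obtain ⟨q, hq⟩ : ∃ q, q = (γ - β) / 2 := ⟨_, rfl⟩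
    rw [h1, show (γ - α) / 2 = p + q by rw [hp, hq]; ring, ← hp, ← hq,
      show γ - β = 2 * q by rw [hq]; ring, show γ - α = 2 * p + 2 * q by rw [hp, hq]; ring,
      show β - α = 2 * p by rw [hp]; ring]
    rw [Real.sin_add (2 * p), Real.sin_add p, Real.sin_two_mul, Real.sin_two_mul, Real.cos_two_mul,
      Real.cos_two_mul]
    have h2 := Real.sin_sq_add_cos_sq p
    have h3 := Real.sin_sq_add_cos_sq q
    linear_combination
      (-4 * Real.sin q * Real.cos q) * h2 + (-4 * Real.sin p * Real.cos p) * h3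
  rw [formula]
  have s1 : 0 < Real.sin ((β - α) / 2) := Real.sin_pos_of_pos_of_lt_pi (by linarith) (by linarith)
  have s2 : 0 < Real.sin ((γ - β) / 2) := Real.sin_pos_of_pos_of_lt_pi (by linarith) (by linarith)
  have s3 : 0 < Real.sin ((γ - α) / 2) := Real.sin_pos_of_pos_of_lt_pi (by linarith) (by linarith)
  positivity

/-- Two segments cross if the ends of each lie strictly on different sides of the other. -/
lemma not_disjoint_openSegment {a b c d : ℂ} (hc : orient a b c < 0) (hd : 0 < orient a b d)
    (ha : 0 < orient c d a) (hb : orient c d b < 0) :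
    ¬ Disjoint (openSegment ℝ a b) (openSegment ℝ c d) := by
  rw [Set.not_disjoint_iff]
  have h1 : 0 < orient c d a - orient c d b := by linarith
  have h2 : 0 < orient a b d - orient a b c := by linarith
  have h12 : orient c d a - orient c d b = orient a b d - orient a b c := by
    simp only [orient]; ring
  refine ⟨(-orient c d b / (orient c d a - orient c d b)) • a
      + (orient c d a / (orient c d a - orient c d b)) • b, ⟨_, _, by
      apply div_pos <;> linarith, by apply div_pos <;> linarith, by field_simp; ring, rfl⟩,
    ⟨orient a b d / (orient c d a - orient c d b), -orient a b c / (orient c d a - orient c d b),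
      by apply div_pos <;> linarith, by apply div_pos <;> linarith, by
        rw [h12]; field_simp; ring, ?_⟩⟩
  apply Complex.ext
  · simp only [Complex.add_re, Complex.real_smul, Complex.mul_re, Complex.ofReal_re,
      Complex.ofReal_im, zero_mul, sub_zero]
    field_simp
    simp only [orient]
    ring
  · simp only [Complex.add_im, Complex.real_smul, Complex.mul_im, Complex.ofReal_re,
      Complex.ofReal_im, zero_mul, add_zero]
    field_simp
    simp only [orient]
    ring

/-- Two segments do not cross if one lies weakly on one side of the line through the other, and
not on that line. -/
lemma disjoint_openSegment {a b c d : ℂ}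
    (h : (0 ≤ orient a b c ∧ 0 ≤ orient a b d ∧ orient a b c + orient a b d ≠ 0) ∨
      (orient a b c ≤ 0 ∧ orient a b d ≤ 0 ∧ orient a b c + orient a b d ≠ 0)) :
    Disjoint (openSegment ℝ a b) (openSegment ℝ c d) := by
  rw [Set.disjoint_iff_forall_ne]
  rintro _ ⟨p, q, -, -, hpq, rfl⟩ _ ⟨x, y, hx, hy, hxy, rfl⟩ heq
  have h0 : orient a b (p • a + q • b) = 0 := by
    obtain rfl : p = 1 - q := by linarith
    simp [orient]; ring
  have h1 : orient a b (x • c + y • d) = x * orient a b c + y * orient a b d := by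
    obtain rfl : x = 1 - y := by linarith
    simp [orient]; ring
  rw [← heq, h0] at h1
  rcases h with ⟨hc, hd, hne⟩ | ⟨hc, hd, hne⟩
  · rcases hc.lt_or_eq with hc | hc
    · nlinarith [mul_pos hx hc, mul_nonneg hy.le hd]
    · rcases hd.lt_or_eq with hd | hd
      · nlinarith [mul_pos hy hd]
      · exact hne (by linarith)
  · rcases hc.lt_or_eq with hc | hc
    · nlinarith [mul_pos hx (neg_pos.2 hc), mul_nonneg hy.le (neg_nonneg.2 hd)]
    · rcases hd.lt_or_eq with hd | hd
      · nlinarith [mul_pos hy (neg_pos.2 hd)]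
      · exact hne (by linarith)

/-! ### Triangulated polygons as ordered graphs -/

/-- No two edges cross when the vertices are placed on a circle in the order of `θ`. -/
def NonCrossing {V : Type*} (G : SimpleGraph V) (θ : V → ℕ) : Prop :=
  ∀ a b c d, G.Adj a b → G.Adj c d → ¬ (θ a < θ c ∧ θ c < θ b ∧ θ b < θ d)

/-- Every chord between vertices of `R` that is not an edge is crossed by an edge inside `R`. -/
def Saturated {V : Type*} (G : SimpleGraph V) (θ : V → ℕ) (R : Finset V) : Prop :=
  ∀ u ∈ R, ∀ v ∈ R, θ u < θ v → ¬ G.Adj u v →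
    ∃ c ∈ R, ∃ d ∈ R, G.Adj c d ∧ θ u < θ c ∧ θ c < θ v ∧ (θ d < θ u ∨ θ v < θ d)

/-- A maximal outerplanar graph is a triangulated polygon, in combinatorial terms: in the order of
the arguments of its vertices, no edges cross and every missing edge would cross some edge. -/
lemma exists_order_of_isMaximalOuterplanar {V : Type*} [Fintype V] {G : SimpleGraph V}
    (hG : IsMaximalOuterplanar G) :
    ∃ θ : V → ℕ, Function.Injective θ ∧ NonCrossing G θ ∧ Saturated G θ Finset.univ := by
  classical
  obtain ⟨⟨pos, hinj, hnorm, hdisj⟩, hmax⟩ := hG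
  -- the rank of a vertex in the order of the arguments
  set θ : V → ℕ := fun v => (Finset.univ.filter fun u => (pos u).arg < (pos v).arg).card with hθ
  have mono : ∀ u v, (pos u).arg < (pos v).arg → θ u < θ v := by
    intro u v huv
    apply Finset.card_lt_card
    rw [Finset.ssubset_iff_of_subset]
    · exact ⟨u, by simpa using huv, by simp⟩
    · intro x hx
      simp only [Finset.mem_filter, Finset.mem_univ, true_and] at hx ⊢
      exact hx.trans huv
  have arginj : ∀ u v, (pos u).arg = (pos v).arg → u = v := by
    intro u v huv
    apply hinj
    rw [← Complex.norm_mul_exp_arg_mul_I (pos u), ← Complex.norm_mul_exp_arg_mul_I (pos v), huv,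
      hnorm, hnorm]
  have mono' : ∀ u v, θ u < θ v → (pos u).arg < (pos v).arg := by
    intro u v huv
    rcases lt_trichotomy (pos u).arg (pos v).arg with h | h | h
    · exact h
    · rw [arginj u v h] at huv
      exact absurd huv (lt_irrefl _)
    · exact absurd (mono v u h) (by omega)
  have θinj : Function.Injective θ := by
    intro u v huv
    rcases lt_trichotomy (pos u).arg (pos v).arg with h | h | h
    · have := mono _ _ h
      omega
    · exact arginj u v h
    · have := mono _ _ h
      omega
  have opos : ∀ a b c, θ a < θ b → θ b < θ c → 0 < orient (pos a) (pos b) (pos c) :=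
    fun a b c hab hbc => orient_pos_of_arg_lt (hnorm _) (hnorm _) (hnorm _) (mono' _ _ hab)
      (mono' _ _ hbc)
  refine ⟨θ, θinj, ?_, ?_⟩
  · rintro a b c d hab hcd ⟨h1, h2, h3⟩
    have hne : s(a, b) ≠ s(c, d) := by
      intro h
      rcases Sym2.eq_iff.1 h with ⟨rfl, rfl⟩ | ⟨rfl, rfl⟩ <;> omega
    refine not_disjoint_openSegment ?_ ?_ ?_ ?_ (hdisj a b c d hab hcd hne)
    · rw [orient_swap]
      linarith [opos a c b h1 h2]
    · exact opos a b d (h1.trans h2) h3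
    · rw [orient_rotate]
      exact opos a c d h1 (h2.trans h3)
    · rw [orient_swap]
      linarith [opos c b d h2 h3]
  · intro u _ v _ huv hadj
    by_contra hno
    push Not at hno
    have hside : ∀ c d, G.Adj c d → θ u < θ c → θ c < θ v → θ u ≤ θ d ∧ θ d ≤ θ v :=
      fun c d hcd h1 h2 => by
        simpa using hno c (Finset.mem_univ _) d (Finset.mem_univ _) hcd h1 h2
    have huv' : u ≠ v := by
      rintro rfl
      omega
    have hzero : orient (pos u) (pos v) (pos u) = 0 ∧ orient (pos u) (pos v) (pos v) = 0 := by
      constructor <;> simp only [orient] <;> ring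
    have hin : ∀ c, θ u ≤ θ c → θ c ≤ θ v → orient (pos u) (pos v) (pos c) ≤ 0 := by
      intro c h1 h2
      rcases h1.lt_or_eq with h1 | h1
      · rcases h2.lt_or_eq with h2 | h2
        · rw [orient_swap]
          linarith [opos u c v h1 h2]
        · rw [θinj h2]
          exact hzero.2.le
      · rw [← θinj h1]
        exact hzero.1.le
    have hout : ∀ c, θ c ≤ θ u ∨ θ v ≤ θ c → 0 ≤ orient (pos u) (pos v) (pos c) := by
      rintro c (h | h)
      · rcases h.lt_or_eq with h | h
        · rw [← orient_rotate, ← orient_rotate]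
          exact (opos c u v h huv).le
        · rw [θinj h]
          exact hzero.1.ge
      · rcases h.lt_or_eq with h | h
        · exact (opos u v c huv h).le
        · rw [← θinj h]
          exact hzero.2.ge
    have hnz : ∀ c, c ≠ u → c ≠ v → orient (pos u) (pos v) (pos c) ≠ 0 := by
      intro c hcu hcv
      rcases lt_trichotomy (θ c) (θ u) with h | h | h
      · rw [← orient_rotate, ← orient_rotate]
        exact (opos c u v h huv).ne'
      · exact absurd (θinj h) hcu
      · rcases lt_trichotomy (θ c) (θ v) with h' | h' | h'
        · rw [orient_swap]
          linarith [opos u c v h h']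
        · exact absurd (θinj h') hcv
        · exact (opos u v c huv h').ne'
    have main : ∀ c d, G.Adj c d →
        Disjoint (openSegment ℝ (pos u) (pos v)) (openSegment ℝ (pos c) (pos d)) := by
      intro c d hcd
      have hne : ¬ ((c = u ∨ c = v) ∧ (d = u ∨ d = v)) := by
        rintro ⟨rfl | rfl, rfl | rfl⟩
        · exact hcd.ne rfl
        · exact hadj hcd
        · exact hadj hcd.symm
        · exact hcd.ne rfl
      apply disjoint_openSegment
      have hsum : (0 ≤ orient (pos u) (pos v) (pos c) ∧ 0 ≤ orient (pos u) (pos v) (pos d)) ∨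
          (orient (pos u) (pos v) (pos c) ≤ 0 ∧ orient (pos u) (pos v) (pos d) ≤ 0) →
          orient (pos u) (pos v) (pos c) + orient (pos u) (pos v) (pos d) ≠ 0 := by
        intro h h0
        refine hne ⟨?_, ?_⟩
        · by_contra hx
          push Not at hx
          exact hnz c hx.1 hx.2 (by rcases h with h | h <;> linarith)
        · by_contra hx
          push Not at hx
          exact hnz d hx.1 hx.2 (by rcases h with h | h <;> linarith)
      have s1 := hside c d hcd
      have s2 := hside d c hcd.symm
      by_cases h : (θ u ≤ θ c ∧ θ c ≤ θ v) ∧ θ u ≤ θ d ∧ θ d ≤ θ v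
      · have i1 := hin c h.1.1 h.1.2
        have i2 := hin d h.2.1 h.2.2
        exact .inr ⟨i1, i2, hsum (.inr ⟨i1, i2⟩)⟩
      · have i1 := hout c (by omega)
        have i2 := hout d (by omega)
        exact .inl ⟨i1, i2, hsum (.inl ⟨i1, i2⟩)⟩
    have main' : ∀ a b, (SimpleGraph.edge u v).Adj a b →
        openSegment ℝ (pos a) (pos b) = openSegment ℝ (pos u) (pos v) ∧ s(a, b) = s(u, v) := by
      intro a b hab
      rw [SimpleGraph.edge_adj] at hab
      rcases hab.1 with ⟨rfl, rfl⟩ | ⟨rfl, rfl⟩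
      · exact ⟨rfl, rfl⟩
      · exact ⟨openSegment_symm _ _ _, Sym2.eq_swap⟩
    refine hmax u v huv' hadj ⟨pos, hinj, hnorm, ?_⟩
    intro a b c d hab hcd hne
    rcases hab with hab | hab <;> rcases hcd with hcd | hcd
    · exact hdisj a b c d hab hcd hne
    · rw [(main' c d hcd).1]
      exact (main a b hab).symm
    · rw [(main' a b hab).1]
      exact main c d hcd
    · exact absurd ((main' a b hab).2.trans (main' c d hcd).2.symm) hne

/-! ### Vertices of degree at most two -/

section Peeling

variable {V : Type*} {G : SimpleGraph V} {θ : V → ℕ} {R : Finset V}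

/-- A missing edge is crossed by an edge with an end strictly between its ends, which is connected
to both of them. -/
lemma Saturated.reachable [Fintype V] (hθ : Function.Injective θ)
    (hs : Saturated G θ Finset.univ) (u v : V) : G.Reachable u v := by
  have key : ∀ k, ∀ u v, θ u < θ v → θ v - θ u ≤ k → G.Reachable u v := by
    intro k
    induction k with
    | zero => intro u v h1 h2; omega
    | succ k ih =>
      intro u v h1 h2
      by_cases hadj : G.Adj u v
      · exact hadj.reachable
      · obtain ⟨c, -, -, -, -, h3, h4, -⟩ :=
          hs u (Finset.mem_univ _) v (Finset.mem_univ _) h1 hadj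
        exact (ih u c h3 (by omega)).trans (ih c v h4 (by omega))
  rcases lt_trichotomy (θ u) (θ v) with h | h | h
  · exact key _ u v h le_rfl
  · rw [hθ h]
  · exact (key _ v u h le_rfl).symm

variable [DecidableRel G.Adj]

/-- In a noncrossing graph some vertex inside the shortest chord has only its two neighbours on
the polygon as neighbours. -/
lemma NonCrossing.exists_degree_le_two (hθ : Function.Injective θ) (hn : NonCrossing G θ)
    (hR : R.Nonempty) : ∃ x ∈ R, (R.filter (G.Adj x)).card ≤ 2 := by
  classical
  -- it suffices to find a vertex none of whose edges spans another vertex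
  suffices h : ∃ x ∈ R, ∀ y ∈ R, G.Adj x y → ∀ z ∈ R,
      ¬ (θ x < θ z ∧ θ z < θ y ∨ θ y < θ z ∧ θ z < θ x) by
    obtain ⟨x, hx, h⟩ := h
    refine ⟨x, hx, ?_⟩
    by_contra hcard
    push Not at hcard
    obtain ⟨a, ha, b, hb, c, hc, hab, hac, hbc⟩ := Finset.two_lt_card.1 hcard
    simp only [Finset.mem_filter] at ha hb hc
    have ab := h a ha.1 ha.2 b hb.1
    have ac := h a ha.1 ha.2 c hc.1
    have ba := h b hb.1 hb.2 a ha.1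
    have bc := h b hb.1 hb.2 c hc.1
    have ca := h c hc.1 hc.2 a ha.1
    have cb := h c hc.1 hc.2 b hb.1
    have n1 := hθ.ne hab
    have n2 := hθ.ne hac
    have n3 := hθ.ne hbc
    have n4 := hθ.ne ha.2.ne
    have n5 := hθ.ne hb.2.ne
    have n6 := hθ.ne hc.2.ne
    omega
  let S : Finset (V × V) := (R ×ˢ R).filter fun e =>
    G.Adj e.1 e.2 ∧ ∃ z ∈ R, θ e.1 < θ z ∧ θ z < θ e.2
  have hS : ∀ u v, (u, v) ∈ S ↔ (u ∈ R ∧ v ∈ R) ∧ G.Adj u v ∧ ∃ z ∈ R, θ u < θ z ∧ θ z < θ v := by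
    intro u v
    simp [S]
  by_cases hne : S.Nonempty
  · obtain ⟨⟨u, w⟩, huw, hmin⟩ := Finset.exists_min_image S (fun e => θ e.2 - θ e.1) hne
    obtain ⟨⟨hu, hw⟩, hadj, x, hx, hux, hxw⟩ := (hS u w).1 huw
    refine ⟨x, hx, fun y hy hxy z hz hxyz => ?_⟩
    have n1 := hn u w x y hadj hxy
    have n2 := hn y x u w hxy.symm hadj
    rcases hxyz with h | h
    · have := hmin (x, y) ((hS x y).2 ⟨⟨hx, hy⟩, hxy, z, hz, h⟩)
      simp only at this
      omega
    · have := hmin (y, x) ((hS y x).2 ⟨⟨hy, hx⟩, hxy.symm, z, hz, h⟩)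
      simp only at this
      omega
  · obtain ⟨x, hx⟩ := hR
    refine ⟨x, hx, fun y hy hxy z hz hxyz => hne ?_⟩
    rcases hxyz with h | h
    · exact ⟨_, (hS x y).2 ⟨⟨hx, hy⟩, hxy, z, hz, h⟩⟩
    · exact ⟨_, (hS y x).2 ⟨⟨hy, hx⟩, hxy.symm, z, hz, h⟩⟩

lemma eq_of_card_filter_adj_le_two {v a b c : V} (hdeg : (R.filter (G.Adj v)).card ≤ 2)
    (ha : a ∈ R) (hb : b ∈ R) (hc : c ∈ R) (hva : G.Adj v a) (hvb : G.Adj v b) (hvc : G.Adj v c)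
    (hab : a ≠ b) : c = a ∨ c = b := by
  by_contra h
  push Not at h
  have := Finset.two_lt_card.2 ⟨a, Finset.mem_filter.2 ⟨ha, hva⟩, b, Finset.mem_filter.2 ⟨hb, hvb⟩,
    c, Finset.mem_filter.2 ⟨hc, hvc⟩, hab, h.1.symm, h.2.symm⟩
  omega

/-- A vertex of degree at most two is simplicial: an edge crossing the chord between its two
neighbours would have to start at the vertex itself. -/
lemma Saturated.adj_of_degree_le_two (hθ : Function.Injective θ) (hn : NonCrossing G θ)
    (hs : Saturated G θ R) {v : V} (hdeg : (R.filter (G.Adj v)).card ≤ 2)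
    {a b : V} (ha : a ∈ R) (hb : b ∈ R) (hva : G.Adj v a) (hvb : G.Adj v b) (hab : a ≠ b) :
    G.Adj a b := by
  wlog hlt : θ a < θ b generalizing a b
  · have hne := hθ.ne hab
    exact (this hb ha hvb hva hab.symm (by omega)).symm
  by_contra hadj
  obtain ⟨c, hc, d, hd, hcd, h1, h2, h3⟩ := hs a ha b hb hlt hadj
  have hca : c ≠ a := by rintro rfl; omega
  have hcb : c ≠ b := by rintro rfl; omega
  have hda : d ≠ a := by rintro rfl; omega
  have hdb : d ≠ b := by rintro rfl; omega
  have hvc : v ≠ c := by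
    rintro rfl
    rcases eq_of_card_filter_adj_le_two hdeg ha hb hd hva hvb hcd hab with h | h
    · exact hda h
    · exact hdb h
  have hvd : v ≠ d := by
    rintro rfl
    rcases eq_of_card_filter_adj_le_two hdeg ha hb hc hva hvb hcd.symm hab with h | h
    · exact hca h
    · exact hcb h
  have := hθ.ne hvc
  have := hθ.ne hvd
  have := hθ.ne hva.ne
  have := hθ.ne hvb.ne
  have n1 := hn v b c d hvb hcd
  have n2 := hn d c v b hcd.symm hvb
  have n3 := hn a v c d hva.symm hcd
  have n4 := hn d c a v hcd.symm hva.symm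
  have n5 := hn v a d c hva hcd.symm
  have n6 := hn c d b v hcd hvb.symm
  omega

/-- Removing a vertex of degree at most two keeps a graph saturated. -/
lemma Saturated.erase [DecidableEq V] (hθ : Function.Injective θ) (hn : NonCrossing G θ)
    (hs : Saturated G θ R) {v : V} (hv : v ∈ R) (hdeg : (R.filter (G.Adj v)).card ≤ 2) :
    Saturated G θ (R.erase v) := by
  intro u hu w hw huw hadj
  rw [Finset.mem_erase] at hu hw
  obtain ⟨c, hc, d, hd, hcd, h1, h2, h3⟩ := hs u hu.2 w hw.2 huw hadj
  have fin : ∀ c ∈ R, ∀ d ∈ R, G.Adj c d → θ c ≠ θ v → θ d ≠ θ v → θ u < θ c → θ c < θ w →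
      (θ d < θ u ∨ θ w < θ d) → ∃ c ∈ R.erase v, ∃ d ∈ R.erase v,
        G.Adj c d ∧ θ u < θ c ∧ θ c < θ w ∧ (θ d < θ u ∨ θ w < θ d) :=
    fun c hc d hd hcd hcv hdv h1 h2 h3 =>
      ⟨c, Finset.mem_erase.2 ⟨fun h => hcv (by rw [h]), hc⟩, d,
        Finset.mem_erase.2 ⟨fun h => hdv (by rw [h]), hd⟩, hcd, h1, h2, h3⟩
  -- an edge from `v` across `uw` leaves `v` only one further neighbour
  have two : ∀ x ∈ R, G.Adj v x → x ≠ u → x ≠ w → ¬ G.Adj u v ∨ ¬ G.Adj v w := by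
    intro x hx hvx hxu hxw
    by_contra h
    push Not at h
    rcases eq_of_card_filter_adj_le_two hdeg hu.2 hw.2 hx h.1.symm h.2 hvx
      (by rintro rfl; omega) with h | h
    · exact hxu h
    · exact hxw h
  by_cases hcv : θ c = θ v
  · obtain rfl := hθ hcv
    -- the edge crossing the missing chord at `v` does not cross the edge from `v` to `d`
    rcases two d hd hcd (by rintro rfl; omega) (by rintro rfl; omega) with h | h
    · obtain ⟨x, hx, y, hy, hxy, k1, k2, k3⟩ := hs u hu.2 c hc h1 h
      have n1 := hn x y c d hxy hcd
      have n2 := hn d c x y hcd.symm hxy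
      exact fin x hx y hy hxy (by omega) (by omega) (by omega) (by omega) (by omega)
    · obtain ⟨x, hx, y, hy, hxy, k1, k2, k3⟩ := hs c hc w hw.2 h2 h
      have n1 := hn y x c d hxy.symm hcd
      have n2 := hn d c y x hcd.symm hxy.symm
      exact fin x hx y hy hxy (by omega) (by omega) (by omega) (by omega) (by omega)
  by_cases hdv : θ d = θ v
  · obtain rfl := hθ hdv
    have n0 := fun x y (hxy : G.Adj x y) => hn d c x y hcd.symm hxy
    have n1 := fun x y (hxy : G.Adj x y) => hn y x d c hxy.symm hcd.symm
    have n2 := fun x y (hxy : G.Adj x y) => hn c d x y hcd hxy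
    have n3 := fun x y (hxy : G.Adj x y) => hn y x c d hxy.symm hcd
    rcases two c hc hcd.symm (by rintro rfl; omega) (by rintro rfl; omega) with h | h
    · rcases h3 with h3 | h3
      · obtain ⟨x, hx, y, hy, hxy, k1, k2, k3⟩ := hs d hd u hu.2 h3 fun k => h k.symm
        have := n0 x y hxy
        have := n1 x y hxy
        exact fin y hy x hx hxy.symm (by omega) (by omega) (by omega) (by omega) (by omega)
      · obtain ⟨x, hx, y, hy, hxy, k1, k2, k3⟩ := hs u hu.2 d hd (by omega) h
        have := n2 x y hxy
        have := n3 x y hxy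
        exact fin x hx y hy hxy (by omega) (by omega) (by omega) (by omega) (by omega)
    · rcases h3 with h3 | h3
      · obtain ⟨x, hx, y, hy, hxy, k1, k2, k3⟩ := hs d hd w hw.2 (by omega) h
        have := n0 x y hxy
        have := n1 x y hxy
        exact fin x hx y hy hxy (by omega) (by omega) (by omega) (by omega) (by omega)
      · obtain ⟨x, hx, y, hy, hxy, k1, k2, k3⟩ := hs w hw.2 d hd h3 fun k => h k.symm
        have := n2 x y hxy
        have := n3 x y hxy
        exact fin y hy x hx hxy.symm (by omega) (by omega) (by omega) (by omega) (by omega)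
  exact fin c hc d hd hcd hcv hdv h1 h2 h3

lemma card_filter_adj_eq_erase_add [DecidableEq V] {v : V} (hv : v ∈ R) (u : V) :
    (R.filter (G.Adj u)).card
      = ((R.erase v).filter (G.Adj u)).card + if G.Adj v u then 1 else 0 := by
  nth_rewrite 1 [← Finset.insert_erase hv]
  rw [Finset.filter_insert]
  by_cases h : G.Adj u v
  · rw [if_pos h, if_pos h.symm, Finset.card_insert_of_notMem (by simp)]
  · rw [if_neg h, if_neg fun h' => h h'.symm, add_zero]

/-- A noncrossing graph has few edges: remove vertices of degree at most two one after the other. -/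
lemma NonCrossing.sum_degree_le [DecidableEq V] (hθ : Function.Injective θ)
    (hn : NonCrossing G θ) (R : Finset V) :
    ∑ u ∈ R, (R.filter (G.Adj u)).card ≤ 4 * R.card := by
  induction hk : R.card generalizing R with
  | zero => simp [Finset.card_eq_zero.1 hk]
  | succ k ih =>
    obtain ⟨v, hv, hdeg⟩ := hn.exists_degree_le_two hθ (R := R) (Finset.card_pos.1 (by omega))
    have hcard : (R.erase v).card = k := by
      rw [Finset.card_erase_of_mem hv]
      omega
    have hcount : ∑ u ∈ R.erase v, (if G.Adj v u then 1 else 0) ≤ 2 := by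
      rw [← Finset.card_filter]
      exact (Finset.card_le_card (Finset.filter_subset_filter _ (Finset.erase_subset v R))).trans
        hdeg
    have := ih (R.erase v) hcard
    rw [← Finset.add_sum_erase R _ hv,
      Finset.sum_congr rfl fun u _ => card_filter_adj_eq_erase_add hv u, Finset.sum_add_distrib]
    omega

end Peeling

/-! ### Weights of walks -/

section Weight

variable {V : Type*} {G : SimpleGraph V} {ω : Sym2 V → ℝ}

lemma weight_nil (u : V) : weight ω (SimpleGraph.Walk.nil : G.Walk u u) = 0 := rfl

lemma weight_append {u v w : V} (p : G.Walk u v) (q : G.Walk v w) :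
    weight ω (p.append q) = weight ω p + weight ω q := by
  simp [weight]

lemma weight_concat {u v w : V} (p : G.Walk u v) (h : G.Adj v w) :
    weight ω (p.concat h) = weight ω p + ω s(v, w) := by
  simp [weight, SimpleGraph.Walk.edges_concat]

lemma weight_nonneg (hω : ∀ e ∈ G.edgeSet, 0 < ω e) {u v : V} (p : G.Walk u v) :
    0 ≤ weight ω p := by
  apply List.sum_nonneg
  simp only [List.mem_map, forall_exists_index, and_imp, forall_apply_eq_imp_iff₂]
  exact fun e he => (hω e (p.edges_subset_edgeSet he)).le

end Weight

/-! ### Relaxation along a perfect elimination order -/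

section Relaxation

variable {V : Type*} [DecidableEq V] {G : SimpleGraph V} {ω : Sym2 V → ℝ}

/-- Relaxation of the edge from `e.1` to `e.2`: the tentative value of `e.2` is replaced by the one
obtained through `e.1` if that is smaller. -/
noncomputable def relax (ω : Sym2 V → ℝ) (f : V → EReal) (e : V × V) : V → EReal :=
  Function.update f e.2 (min (f e.2) (f e.1 + (ω s(e.1, e.2) : EReal)))

/-- The relaxations of the edges of a list, one after the other. -/
noncomputable def relaxAll (ω : Sym2 V → ℝ) (f : V → EReal) (L : List (V × V)) : V → EReal :=
  L.foldl (relax ω) f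

lemma relaxAll_cons (f : V → EReal) (e : V × V) (L : List (V × V)) :
    relaxAll ω f (e :: L) = relaxAll ω (relax ω f e) L := rfl

lemma relaxAll_append (f : V → EReal) (L L' : List (V × V)) :
    relaxAll ω f (L ++ L') = relaxAll ω (relaxAll ω f L) L' := List.foldl_append

lemma relax_le (f : V → EReal) (e : V × V) : relax ω f e ≤ f := by
  intro v
  by_cases h : v = e.2
  · subst h
    simp [relax]
  · simp [relax, h]

lemma relax_mono {f g : V → EReal} (h : f ≤ g) (e : V × V) : relax ω f e ≤ relax ω g e := by
  intro v
  by_cases hv : v = e.2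
  · subst hv
    simp only [relax, Function.update_self]
    exact min_le_min (h _) (add_le_add (h _) le_rfl)
  · simpa [relax, hv] using h v

lemma relaxAll_le (f : V → EReal) (L : List (V × V)) : relaxAll ω f L ≤ f := by
  induction L generalizing f with
  | nil => exact le_rfl
  | cons e L ih => exact (ih _).trans (relax_le f e)

lemma relaxAll_mono {f g : V → EReal} (h : f ≤ g) (L : List (V × V)) :
    relaxAll ω f L ≤ relaxAll ω g L := by
  induction L generalizing f g with
  | nil => exact h
  | cons e L ih => exact ih (relax_mono h e)

/-- Additional relaxations never hurt. -/
lemma relaxAll_le_of_sublist {L L' : List (V × V)} (h : L'.Sublist L) (f : V → EReal) :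
    relaxAll ω f L ≤ relaxAll ω f L' := by
  induction h generalizing f with
  | slnil => exact le_rfl
  | cons e _ ih => exact (relaxAll_mono (relax_le f e) _).trans (ih f)
  | cons_cons e _ ih => exact ih _

lemma relaxAll_apply_of_notMem {L : List (V × V)} {v : V} (h : ∀ e ∈ L, e.2 ≠ v) (f : V → EReal) :
    relaxAll ω f L v = f v := by
  induction L generalizing f with
  | nil => rfl
  | cons e L ih =>
    rw [relaxAll_cons, ih fun e' he' => h e' (List.mem_cons_of_mem _ he')]
    simp [relax, (h e List.mem_cons_self).symm]

lemma relaxAll_le_of_mem {L : List (V × V)} {x y : V} (hxy : (x, y) ∈ L) (h : ∀ e ∈ L, e.2 ≠ x)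
    (f : V → EReal) : relaxAll ω f L y ≤ f x + (ω s(x, y) : EReal) := by
  induction L generalizing f with
  | nil => simp at hxy
  | cons e L ih =>
    have hx : relax ω f e x = f x := by simp [relax, (h e List.mem_cons_self).symm]
    rw [relaxAll_cons]
    rcases List.mem_cons.1 hxy with rfl | hmem
    · exact (relaxAll_le _ _ _).trans (by simp [relax])
    · rw [← hx]
      exact ih hmem (fun e' he' => h e' (List.mem_cons_of_mem _ he')) _

lemma relaxAll_eq_or_exists {L : List (V × V)} {y : V} (h : ∀ e ∈ L, e.1 ≠ y)
    (hy : ∀ e ∈ L, e.2 = y) (f : V → EReal) :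
    relaxAll ω f L y = f y ∨ ∃ x, (x, y) ∈ L ∧ relaxAll ω f L y = f x + (ω s(x, y) : EReal) := by
  induction L generalizing f with
  | nil => exact .inl rfl
  | cons e L ih =>
    obtain ⟨x, z⟩ := e
    obtain rfl : z = y := hy _ List.mem_cons_self
    have hval : ∀ x', x' ≠ z → relax ω f (x, z) x' = f x' := fun x' hx' => by simp [relax, hx']
    rw [relaxAll_cons]
    rcases ih (fun e' he' => h e' (List.mem_cons_of_mem _ he'))
      (fun e' he' => hy e' (List.mem_cons_of_mem _ he')) (relax ω f (x, z)) with h1 | ⟨x', hx', h1⟩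
    · rw [h1]
      rcases min_choice (f z) (f x + (ω s(x, z) : EReal)) with h2 | h2
      · left
        simp [relax, h2]
      · right
        exact ⟨x, List.mem_cons_self, by simp [relax, h2]⟩
    · right
      refine ⟨x', List.mem_cons_of_mem _ hx', ?_⟩
      rw [h1, hval x' (h _ (List.mem_cons_of_mem _ hx'))]

/-- Tentative values are always realized by walks. -/
lemma exists_walk_of_relaxAll {L : List (V × V)} (hL : ∀ e ∈ L, G.Adj e.1 e.2) (f : V → EReal)
    (v : V) : ∃ (x : V) (p : G.Walk x v), relaxAll ω f L v = f x + (weight ω p : EReal) := by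
  induction L generalizing f with
  | nil => exact ⟨v, .nil, by simp [relaxAll, weight_nil]⟩
  | cons e L ih =>
    obtain ⟨x, p, hp⟩ := ih (fun e' he' => hL e' (List.mem_cons_of_mem _ he')) (relax ω f e)
    rw [relaxAll_cons, hp]
    by_cases hx : x = e.2
    · subst hx
      rcases min_choice (f e.2) (f e.1 + (ω s(e.1, e.2) : EReal)) with h | h
      · exact ⟨e.2, p, by simp [relax, h]⟩
      · refine ⟨e.1, .cons (hL e List.mem_cons_self) p, ?_⟩
        simp [relax, h, weight, add_assoc]
    · exact ⟨x, p, by simp [relax, hx]⟩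

/-- A perfect elimination order: the neighbours of a vertex later in the order are pairwise
adjacent. -/
def IsEliminationOrder (G : SimpleGraph V) : List V → Prop
  | [] => True
  | v :: L => v ∉ L ∧
      (∀ a ∈ L, ∀ b ∈ L, G.Adj v a → G.Adj v b → a ≠ b → G.Adj a b) ∧ IsEliminationOrder G L

/-- The relaxations of one sweep: every vertex sends its value to its neighbours, in the given
order, and then every vertex asks its neighbours for their values, in the reverse order. -/
def sweepEdges (adj : V → List V) (L : List V) : List (V × V) :=
  (L.flatMap fun v => (adj v).map fun u => (v, u)) ++
    L.reverse.flatMap fun v => (adj v).map fun u => (u, v)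

/-- The relaxations in a sweep that matter: from each vertex to later ones, and back. -/
def orderedSweepEdges (adj : V → List V) : List V → List (V × V)
  | [] => []
  | v :: L => ((adj v).filter fun u => decide (u ∈ L)).map (fun u => (v, u)) ++
      (orderedSweepEdges adj L ++ ((adj v).filter fun u => decide (u ∈ L)).map fun u => (u, v))

lemma orderedSweepEdges_sublist (adj : V → List V) (L : List V) :
    (orderedSweepEdges adj L).Sublist (sweepEdges adj L) := by
  induction L with
  | nil => simp [orderedSweepEdges, sweepEdges]
  | cons v L ih =>
    have : sweepEdges adj (v :: L) = (adj v).map (fun u => (v, u)) ++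
        (sweepEdges adj L ++ (adj v).map fun u => (u, v)) := by
      simp [sweepEdges]
    rw [this, orderedSweepEdges]
    exact (List.filter_sublist.map _).append (ih.append (List.filter_sublist.map _))

lemma snd_mem_of_mem_orderedSweepEdges {adj : V → List V} {L : List V} {e : V × V}
    (he : e ∈ orderedSweepEdges adj L) : e.2 ∈ L := by
  induction L with
  | nil => simp [orderedSweepEdges] at he
  | cons v L ih =>
    simp only [orderedSweepEdges, List.mem_append, List.mem_map, List.mem_filter,
      decide_eq_true_eq] at he
    rcases he with ⟨u, hu, rfl⟩ | he | ⟨u, hu, rfl⟩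
    · exact List.mem_cons_of_mem _ hu.2
    · exact List.mem_cons_of_mem _ (ih he)
    · exact List.mem_cons_self

/-- After a sweep along a perfect elimination order no edge can be relaxed any more.  A detour
through an eliminated vertex is not shorter than the edge between its two later neighbours, so the
values of the later vertices are final when the vertex asks for them. -/
lemma relaxAll_orderedSweepEdges_le {adj : V → List V} (hadj : ∀ u v, u ∈ adj v ↔ G.Adj v u)
    (hω : ∀ u v, G.Adj u v → 0 ≤ ω s(u, v))
    (htri : ∀ a b v, G.Adj v a → G.Adj v b → G.Adj a b → ω s(a, b) ≤ ω s(a, v) + ω s(v, b))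
    {L : List V} (hL : IsEliminationOrder G L) (f : V → EReal) :
    ∀ x ∈ L, ∀ y ∈ L, G.Adj x y →
      relaxAll ω f (orderedSweepEdges adj L) y
        ≤ relaxAll ω f (orderedSweepEdges adj L) x + (ω s(x, y) : EReal) := by
  induction L generalizing f with
  | nil => simp
  | cons v L ih =>
    obtain ⟨hvL, hsimp, hL⟩ := hL
    rw [orderedSweepEdges, relaxAll_append, relaxAll_append]
    set N := (adj v).filter fun u => decide (u ∈ L) with hN
    have hmem : ∀ u, u ∈ N ↔ G.Adj v u ∧ u ∈ L := by
      intro u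
      simp [hN, hadj]
    set f₁ := relaxAll ω f (N.map fun u => (v, u)) with hf₁
    set f₂ := relaxAll ω f₁ (orderedSweepEdges adj L) with hf₂
    set f₃ := relaxAll ω f₂ (N.map fun u => (u, v)) with hf₃
    have hne : ∀ x ∈ L, x ≠ v := fun x hx h => hvL (h ▸ hx)
    have h₁v : f₁ v = f v := relaxAll_apply_of_notMem (by
      simp only [List.mem_map, forall_exists_index, and_imp, forall_apply_eq_imp_iff₂]
      exact fun u hu => hne u ((hmem u).1 hu).2) f
    have h₁ : ∀ u ∈ L, G.Adj v u → f₁ u ≤ f v + (ω s(v, u) : EReal) := fun u hu hvu =>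
      relaxAll_le_of_mem (List.mem_map_of_mem ((hmem u).2 ⟨hvu, hu⟩)) (by
        simp only [List.mem_map, forall_exists_index, and_imp, forall_apply_eq_imp_iff₂]
        exact fun u hu => hne u ((hmem u).1 hu).2) f
    have h₂v : f₂ v = f v := by
      rw [← h₁v]
      exact relaxAll_apply_of_notMem
        (fun e he => hne _ (snd_mem_of_mem_orderedSweepEdges he)) f₁
    have h₃ : ∀ x ∈ L, f₃ x = f₂ x := fun x hx => relaxAll_apply_of_notMem (by
      simp only [List.mem_map, forall_exists_index, and_imp, forall_apply_eq_imp_iff₂]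
      exact fun u _ => (hne x hx).symm) f₂
    have h₃v : ∀ u ∈ L, G.Adj v u → f₃ v ≤ f₂ u + (ω s(u, v) : EReal) := fun u hu hvu => by
      have hle := relaxAll_le_of_sublist (ω := ω)
        (List.singleton_sublist.2 (List.mem_map_of_mem (f := fun u => (u, v))
          ((hmem u).2 ⟨hvu, hu⟩))) f₂ v
      refine hle.trans ?_
      simp [relaxAll, relax]
    have h₃v' := relaxAll_eq_or_exists (ω := ω) (L := N.map fun u => (u, v)) (y := v) (by
      simp only [List.mem_map, forall_exists_index, and_imp, forall_apply_eq_imp_iff₂]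
      exact fun u hu => hne u ((hmem u).1 hu).2) (by simp) f₂
    have hfinal : ∀ u ∈ L, G.Adj v u → f₂ u ≤ f₃ v + (ω s(v, u) : EReal) := by
      intro u hu hvu
      rcases h₃v' with h | ⟨x, hx, h⟩
      · rw [hf₃, h, h₂v]
        exact (relaxAll_le _ _ _).trans (h₁ u hu hvu)
      · simp only [List.mem_map, Prod.mk.injEq, and_true, exists_eq_right, hmem] at hx
        rw [hf₃, h, add_assoc, ← EReal.coe_add]
        by_cases hxu : x = u
        · subst hxu
          have h0 : (0 : EReal) ≤ ((ω s(x, v) + ω s(v, x) : ℝ) : EReal) := by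
            have h1 := hω x v hvu.symm
            have h2 := hω v x hvu
            exact_mod_cast add_nonneg h1 h2
          exact le_add_of_nonneg_right h0
        · refine (ih hL f₁ x hx.2 u hu (hsimp x hx.2 u hu hx.1 hvu hxu)).trans ?_
          refine add_le_add le_rfl ?_
          exact_mod_cast htri x u v hx.1 hvu (hsimp x hx.2 u hu hx.1 hvu hxu)
    intro x hx y hy hxy
    rcases List.mem_cons.1 hx with rfl | hx <;> rcases List.mem_cons.1 hy with rfl | hy
    · exact absurd rfl hxy.ne
    · rw [h₃ y hy]
      exact hfinal y hy hxy
    · rw [h₃ x ‹_›]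
      exact h₃v x ‹_› hxy.symm
    · rw [h₃ x hx, h₃ y hy]
      exact ih hL f₁ x hx y hy hxy

/-- A sweep along a perfect elimination order of all vertices computes the distances from a set
of sources with given initial values. -/
lemma relaxAll_sweepEdges_le {adj : V → List V} (hadj : ∀ u v, u ∈ adj v ↔ G.Adj v u)
    (hω : ∀ u v, G.Adj u v → 0 ≤ ω s(u, v))
    (htri : ∀ a b v, G.Adj v a → G.Adj v b → G.Adj a b → ω s(a, b) ≤ ω s(a, v) + ω s(v, b))
    {L : List V} (hL : IsEliminationOrder G L) (hmem : ∀ v, v ∈ L) (f : V → EReal)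
    {x v : V} (p : G.Walk x v) :
    relaxAll ω f (sweepEdges adj L) v ≤ f x + (weight ω p : EReal) := by
  refine (relaxAll_le_of_sublist (orderedSweepEdges_sublist adj L) f v).trans ?_
  induction p using SimpleGraph.Walk.concatRec with
  | Hnil => simpa [weight_nil] using relaxAll_le f _ _
  | Hconcat p h ih =>
    rw [weight_concat, EReal.coe_add, ← add_assoc]
    exact (relaxAll_orderedSweepEdges_le hadj hω htri hL f _ (hmem _) _ (hmem _) h).trans
      (add_le_add ih le_rfl)

end Relaxation

/-! ### Reasoning about programs -/

/-- The integer registers that a program may write. -/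
def Program.regs : Program → List ℕ
  | .setReg k _ => [k]
  | .seq c d => c.regs ++ d.regs
  | .branch _ c d => c.regs ++ d.regs
  | .loop _ c => c.regs
  | _ => []

/-- The integer arrays that a program may write. -/
def Program.nats : Program → List ℕ
  | .setNat k _ _ => [k]
  | .seq c d => c.nats ++ d.nats
  | .branch _ c d => c.nats ++ d.nats
  | .loop _ c => c.nats
  | _ => []

/-- The real arrays that a program may write. -/
def Program.reals : Program → List ℕ
  | .setReal k _ _ => [k]
  | .seq c d => c.reals ++ d.reals
  | .branch _ c d => c.reals ++ d.reals
  | .loop _ c => c.reals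
  | _ => []

/-- Two memories differ only in places that the program may write (and in the output). -/
structure Program.Agree (c : Program) (m m' : Memory) : Prop where
  reg : ∀ k, k ∉ c.regs → m'.reg k = m.reg k
  nat : ∀ k, k ∉ c.nats → m'.nat k = m.nat k
  real : ∀ k, k ∉ c.reals → m'.real k = m.real k

lemma Program.Agree.refl (c : Program) (m : Memory) : c.Agree m m :=
  ⟨fun _ _ => rfl, fun _ _ => rfl, fun _ _ => rfl⟩

lemma Program.Agree.trans {c : Program} {m₁ m₂ m₃ : Memory} (h : c.Agree m₁ m₂)
    (h' : c.Agree m₂ m₃) : c.Agree m₁ m₃ :=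
  ⟨fun k hk => (h'.reg k hk).trans (h.reg k hk), fun k hk => (h'.nat k hk).trans (h.nat k hk),
    fun k hk => (h'.real k hk).trans (h.real k hk)⟩

lemma Program.Agree.mono {c d : Program} {m m' : Memory} (h : c.Agree m m')
    (h₁ : c.regs ⊆ d.regs) (h₂ : c.nats ⊆ d.nats) (h₃ : c.reals ⊆ d.reals) : d.Agree m m' :=
  ⟨fun k hk => h.reg k fun h' => hk (h₁ h'), fun k hk => h.nat k fun h' => hk (h₂ h'),
    fun k hk => h.real k fun h' => hk (h₃ h')⟩

/-- The frame rule: an execution changes the memory only where the text of the program writes. -/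
lemma Exec.agree {c : Program} {m m' : Memory} {t : ℕ} (h : Exec c m t m') : c.Agree m m' := by
  induction h with
  | skip m => exact .refl _ _
  | setReg m k e =>
    refine ⟨fun k' hk => ?_, fun _ _ => rfl, fun _ _ => rfl⟩
    simp only [Program.regs, List.mem_singleton] at hk
    simp [Memory.setReg, hk]
  | setNat m k i e =>
    refine ⟨fun _ _ => rfl, fun k' hk => ?_, fun _ _ => rfl⟩
    simp only [Program.nats, List.mem_singleton] at hk
    simp [Memory.setNat, hk]
  | setReal m k i e =>
    refine ⟨fun _ _ => rfl, fun _ _ => rfl, fun k' hk => ?_⟩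
    simp only [Program.reals, List.mem_singleton] at hk
    simp [Memory.setReal, hk]
  | emit m e => exact ⟨fun _ _ => rfl, fun _ _ => rfl, fun _ _ => rfl⟩
  | seq _ _ ih₁ ih₂ =>
    exact (ih₁.mono (List.subset_append_left _ _) (List.subset_append_left _ _)
      (List.subset_append_left _ _)).trans (ih₂.mono (List.subset_append_right _ _)
      (List.subset_append_right _ _) (List.subset_append_right _ _))
  | branchTrue _ _ ih =>
    exact ih.mono (List.subset_append_left _ _) (List.subset_append_left _ _)
      (List.subset_append_left _ _)
  | branchFalse _ _ ih =>
    exact ih.mono (List.subset_append_right _ _) (List.subset_append_right _ _)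
      (List.subset_append_right _ _)
  | loopTrue _ _ _ ih₁ ih₂ => exact Program.Agree.trans ⟨ih₁.reg, ih₁.nat, ih₁.real⟩ ih₂
  | loopFalse _ => exact .refl _ _

/-- Total correctness with a time bound: started with memory `m`, the program `c` terminates within
`T` steps with a memory that satisfies `Q`. -/
def Runs (c : Program) (m : Memory) (T : ℕ) (Q : Memory → Prop) : Prop :=
  ∃ t m', Exec c m t m' ∧ t ≤ T ∧ Q m'

lemma Runs.weaken {c : Program} {m : Memory} {T T' : ℕ} {Q Q' : Memory → Prop}
    (h : Runs c m T Q) (hT : T ≤ T') (hQ : ∀ m', c.Agree m m' → Q m' → Q' m') :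
    Runs c m T' Q' := by
  obtain ⟨t, m', he, ht, hq⟩ := h
  exact ⟨t, m', he, ht.trans hT, hQ m' he.agree hq⟩

lemma Runs.seq {c d : Program} {m : Memory} {T₁ T₂ T : ℕ} {Q Q₁ : Memory → Prop}
    (h : Runs c m T₁ Q₁) (h' : ∀ m', c.Agree m m' → Q₁ m' → Runs d m' T₂ Q)
    (hT : T₁ + T₂ ≤ T) : Runs (.seq c d) m T Q := by
  obtain ⟨t, m', he, ht, hq⟩ := h
  obtain ⟨t', m'', he', ht', hq'⟩ := h' m' he.agree hq
  exact ⟨t + t', m'', .seq he he', by omega, hq'⟩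

lemma Runs.setReg {k : ℕ} {e : NExp} {m : Memory} {T : ℕ} {Q : Memory → Prop}
    (h : Q (m.setReg k (e.eval m))) (hT : e.cost + 1 ≤ T) : Runs (.setReg k e) m T Q :=
  ⟨_, _, .setReg m k e, hT, h⟩

/-- Loops, with the time `T` still available as the variant. -/
lemma Runs.loop {b : Test} {c : Program} {Q : Memory → Prop} (I : ℕ → Memory → Prop)
    (h : ∀ T m, I T m → (¬ b.Holds m ∧ b.cost ≤ T ∧ Q m) ∨
      (b.Holds m ∧ ∃ T₁ T₂, b.cost + T₁ + T₂ ≤ T ∧ Runs c m T₁ (I T₂)))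
    {T : ℕ} {m : Memory} (hI : I T m) : Runs (.loop b c) m T Q := by
  have hb : 0 < b.cost := by cases b <;> simp [Test.cost]
  induction T using Nat.strong_induction_on generalizing m with
  | _ T ih =>
    rcases h T m hI with ⟨hb', hT, hq⟩ | ⟨hb', T₁, T₂, hT, t, m', he, ht, hI'⟩
    · exact ⟨_, m, .loopFalse hb', hT, hq⟩
    · obtain ⟨t', m'', he', ht', hq⟩ := ih T₂ (by omega) hI'
      exact ⟨_, m'', .loopTrue hb' he he', by omega, hq⟩

lemma Runs.loop_of_not_holds {b : Test} {c : Program} {m : Memory} {T : ℕ} {Q : Memory → Prop}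
    (hb : ¬ b.Holds m) (hT : b.cost ≤ T) (hQ : Q m) : Runs (.loop b c) m T Q :=
  ⟨_, m, .loopFalse hb, hT, hQ⟩

lemma Runs.loop_of_holds {b : Test} {c : Program} {m : Memory} {T T₁ T₂ : ℕ}
    {Q Q₁ : Memory → Prop} (hb : b.Holds m) (h : Runs c m T₁ Q₁)
    (h' : ∀ m', Q₁ m' → Runs (.loop b c) m' T₂ Q) (hT : b.cost + T₁ + T₂ ≤ T) :
    Runs (.loop b c) m T Q := by
  obtain ⟨t, m', he, ht, hq⟩ := h
  obtain ⟨t', m'', he', ht', hq'⟩ := h' m' hq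
  exact ⟨_, m'', .loopTrue hb he he', by omega, hq'⟩

/-- Whether a program has no loop. -/
def Program.straight : Program → Bool
  | .seq c d => c.straight && d.straight
  | .branch _ c d => c.straight && d.straight
  | .loop _ _ => false
  | _ => true

/-- The largest number of steps of a program without loops. -/
def Program.time : Program → ℕ
  | .skip => 1
  | .setReg _ e => e.cost + 1
  | .setNat _ i e => i.cost + e.cost + 1
  | .setReal _ i e => i.cost + e.cost + 1
  | .emit e => e.cost + 1
  | .seq c d => c.time + d.time
  | .branch b c d => b.cost + max c.time d.time
  | .loop _ _ => 0

open Classical in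
/-- The memory after the execution of a program without loops. -/
noncomputable def Program.run (m : Memory) : Program → Memory
  | .skip => m
  | .setReg k e => m.setReg k (e.eval m)
  | .setNat k i e => m.setNat k (i.eval m) (e.eval m)
  | .setReal k i e => m.setReal k (i.eval m) (e.eval m)
  | .emit e => m.emit (e.eval m)
  | .seq c d => d.run (c.run m)
  | .branch b c d => if b.Holds m then c.run m else d.run m
  | .loop _ _ => m

lemma Program.run_seq (c d : Program) (m : Memory) :
    (Program.seq c d).run m = d.run (c.run m) := rfl

lemma Program.run_branch_of_holds {b : Test} {m : Memory} (h : b.Holds m) (c d : Program) :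
    (Program.branch b c d).run m = c.run m := by
  simp [Program.run, h]

lemma Program.run_branch_of_not_holds {b : Test} {m : Memory} (h : ¬ b.Holds m) (c d : Program) :
    (Program.branch b c d).run m = d.run m := by
  simp [Program.run, h]

/-- Programs without loops are evaluated. -/
lemma Runs.straight {c : Program} {m : Memory} {T : ℕ} {Q : Memory → Prop}
    (hc : c.straight = true) (hT : c.time ≤ T) (hQ : Q (c.run m)) : Runs c m T Q := by
  suffices h : ∃ t, Exec c m t (c.run m) ∧ t ≤ c.time by
    obtain ⟨t, he, ht⟩ := h
    exact ⟨t, _, he, ht.trans hT, hQ⟩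
  clear hT hQ
  induction c generalizing m with
  | skip => exact ⟨_, .skip m, le_rfl⟩
  | setReg k e => exact ⟨_, .setReg m k e, le_rfl⟩
  | setNat k i e => exact ⟨_, .setNat m k i e, le_rfl⟩
  | setReal k i e => exact ⟨_, .setReal m k i e, le_rfl⟩
  | emit e => exact ⟨_, .emit m e, le_rfl⟩
  | seq c d ih₁ ih₂ =>
    simp only [Program.straight, Bool.and_eq_true] at hc
    obtain ⟨t₁, h₁, ht₁⟩ := ih₁ (m := m) hc.1
    obtain ⟨t₂, h₂, ht₂⟩ := ih₂ (m := c.run m) hc.2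
    exact ⟨_, .seq h₁ h₂, Nat.add_le_add ht₁ ht₂⟩
  | branch b c d ih₁ ih₂ =>
    simp only [Program.straight, Bool.and_eq_true] at hc
    by_cases hb : b.Holds m
    · obtain ⟨t, h, ht⟩ := ih₁ (m := m) hc.1
      refine ⟨_, .branchTrue hb ?_, Nat.add_le_add_left (ht.trans (le_max_left _ _)) _⟩
      simpa [Program.run, hb] using h
    · obtain ⟨t, h, ht⟩ := ih₂ (m := m) hc.2
      refine ⟨_, .branchFalse hb ?_, Nat.add_le_add_left (ht.trans (le_max_right _ _)) _⟩
      simpa [Program.run, hb] using h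
  | loop b c => simp [Program.straight] at hc

/-! ### Loops over vertices and over adjacency lists -/

/-- Execution of `body` with `0, …, n - 1` in register `4`. -/
def forUp (body : Program) : Program :=
  .seq (.setReg 4 (.const 0))
    (.loop (.natLt (.reg 4) (.reg 0)) (.seq body (.setReg 4 (.succ (.reg 4)))))

/-- Execution of `body` with `N - 1, …, 0` in register `4`, where `N` is the value of
register `r`. -/
def forDown (r : ℕ) (body : Program) : Program :=
  .seq (.setReg 4 (.reg r))
    (.loop (.natLt (.const 0) (.reg 4)) (.seq (.setReg 4 (.pred (.reg 4))) body))

/-- Execution of `body` with register `6` running through the adjacency list that starts there. -/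
def forDarts (body : Program) : Program :=
  .loop (.natLt (.const 0) (.reg 6)) (.seq body (.setReg 6 (.cell 6 (.reg 6))))

/-- Loop rule for `forUp`, with the invariant `J i` before the execution of the body for `i`; the
number in register `4` is not part of the invariant. -/
lemma runs_forUp {body : Program} {m : Memory} (J : ℕ → Memory → Prop) (T : ℕ → ℕ)
    (h₀ : 0 ∉ body.regs) (h₄ : 4 ∉ body.regs) (hJ : ∀ i m k, J i m → J i (m.setReg 4 k))
    (hinit : J 0 m)
    (hstep : ∀ i m', i < m.reg 0 → m'.reg 4 = i → (forUp body).Agree m m' → J i m' →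
      Runs body m' (T i) (J (i + 1))) :
    Runs (forUp body) m (∑ i ∈ Finset.range (m.reg 0), (T i + 6) + 5) (J (m.reg 0)) := by
  have hsub : ∀ {m'}, (forUp body).Agree m m' → ∀ {m''},
      (Program.loop (.natLt (.reg 4) (.reg 0)) (.seq body (.setReg 4 (.succ (.reg 4))))).Agree
        m' m'' → (forUp body).Agree m m'' := fun h _ h' =>
    h.trans (h'.mono (List.subset_append_right _ _) (List.subset_append_right _ _)
      (List.subset_append_right _ _))
  have hreg0 : ∀ {m'}, (forUp body).Agree m m' → m'.reg 0 = m.reg 0 := fun h =>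
    h.reg 0 (by simp [forUp, Program.regs, h₀])
  refine Runs.seq (Q₁ := fun m' => m'.reg 4 = 0 ∧ J 0 m') (T₁ := 2)
    (T₂ := ∑ i ∈ Finset.range (m.reg 0), (T i + 6) + 3)
    (Runs.setReg ⟨by simp [Memory.setReg, NExp.eval], hJ _ _ _ hinit⟩ le_rfl) ?_ (by omega)
  rintro m₁ ha₁ ⟨h4, hJ0⟩
  refine Runs.loop (fun t m' => ∃ i ≤ m.reg 0, m'.reg 4 = i ∧ (forUp body).Agree m m' ∧
    J i m' ∧ t = ∑ k ∈ Finset.Ico i (m.reg 0), (T k + 6) + 3) ?_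
    ⟨0, Nat.zero_le _, h4, ha₁.mono (List.subset_append_left _ _) (List.subset_append_left _ _)
      (List.subset_append_left _ _), hJ0, by rw [Finset.range_eq_Ico]⟩
  rintro t m' ⟨i, hi, h4, ha, hJi, rfl⟩
  rcases hi.lt_or_eq with hi | rfl
  · right
    refine ⟨by simpa [Test.Holds, NExp.eval, h4, hreg0 ha] using hi, T i + 3,
      ∑ k ∈ Finset.Ico (i + 1) (m.reg 0), (T k + 6) + 3, ?_, ?_⟩
    · rw [Finset.sum_eq_sum_Ico_succ_bot hi]
      simp only [Test.cost, NExp.cost]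
      omega
    · refine Runs.seq (hstep i m' hi h4 ha hJi) (T₂ := 3) ?_ le_rfl
      intro m'' ha' hJ'
      have h4' : m''.reg 4 = i := (ha'.reg 4 h₄).trans h4
      have ha'' : (forUp body).Agree m (m''.setReg 4 (m''.reg 4 + 1)) := by
        refine hsub ha (Program.Agree.trans (ha'.mono ?_ ?_ ?_)
          ((Exec.setReg m'' 4 (.succ (.reg 4))).agree.mono ?_ ?_ ?_)) <;>
          simp [Program.regs, Program.nats, Program.reals]
      exact Runs.setReg ⟨i + 1, hi, by simp [Memory.setReg, NExp.eval, h4'], ha'', hJ _ _ _ hJ',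
        rfl⟩ le_rfl
  · left
    exact ⟨by simp [Test.Holds, NExp.eval, h4, hreg0 ha], by simp [Test.cost, NExp.cost], hJi⟩

/-- Loop rule for `forDown`, with the invariant `J i` after the execution of the body for `i`. -/
lemma runs_forDown {r : ℕ} {body : Program} {m : Memory} (J : ℕ → Memory → Prop) (T : ℕ → ℕ)
    (h₄ : 4 ∉ body.regs) (hJ : ∀ i m k, J i m → J i (m.setReg 4 k)) (hinit : J (m.reg r) m)
    (hstep : ∀ i m', i < m.reg r → m'.reg 4 = i → (forDown r body).Agree m m' → J (i + 1) m' →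
      Runs body m' (T i) (J i)) :
    Runs (forDown r body) m (∑ i ∈ Finset.range (m.reg r), (T i + 6) + 5) (J 0) := by
  refine Runs.seq (Q₁ := fun m' => m'.reg 4 = m.reg r ∧ J (m.reg r) m') (T₁ := 2)
    (T₂ := ∑ i ∈ Finset.range (m.reg r), (T i + 6) + 3)
    (Runs.setReg ⟨by simp [Memory.setReg, NExp.eval], hJ _ _ _ hinit⟩ le_rfl) ?_ (by omega)
  rintro m₁ ha₁ ⟨h4, hJ0⟩
  refine Runs.loop (fun t m' => ∃ i ≤ m.reg r, m'.reg 4 = i ∧ (forDown r body).Agree m m' ∧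
    J i m' ∧ t = ∑ k ∈ Finset.range i, (T k + 6) + 3) ?_
    ⟨m.reg r, le_rfl, h4, ha₁.mono (List.subset_append_left _ _) (List.subset_append_left _ _)
      (List.subset_append_left _ _), hJ0, rfl⟩
  rintro t m' ⟨i, hi, h4, ha, hJi, rfl⟩
  cases i with
  | zero => exact .inl ⟨by simp [Test.Holds, NExp.eval, h4], by simp [Test.cost, NExp.cost], hJi⟩
  | succ i =>
    right
    refine ⟨by simp [Test.Holds, NExp.eval, h4], T i + 3, ∑ k ∈ Finset.range i, (T k + 6) + 3,
      ?_, ?_⟩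
    · rw [Finset.sum_range_succ]
      simp only [Test.cost, NExp.cost]
      omega
    · have ha' : (forDown r body).Agree m (m'.setReg 4 i) := by
        refine ha.trans ((Exec.setReg m' 4 (.const i)).agree.mono ?_ ?_ ?_) <;>
          simp [forDown, Program.regs, Program.nats, Program.reals]
      refine Runs.seq (Q₁ := fun m'' => m'' = m'.setReg 4 i) (T₁ := 3) (T₂ := T i)
        (Runs.setReg (by simp [NExp.eval, h4]) le_rfl) ?_ (by omega)
      rintro _ - rfl
      refine (hstep i _ (by omega) (by simp [Memory.setReg]) ha' (hJ _ _ _ hJi)).weaken le_rfl ?_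
      intro m'' hb hJ'
      refine ⟨i, by omega, ?_, ha'.trans (hb.mono ?_ ?_ ?_), hJ', rfl⟩
      · rw [hb.reg 4 h₄]
        simp [Memory.setReg]
      all_goals simp [forDown, Program.regs, Program.nats, Program.reals]

/-- The linked list that starts at the dart `h` consists of darts from `v` to the vertices of the
given list.  The arrays hold the ends, the successors and the weights of the darts `1, …, K`; the
number `0` marks the end of a list. -/
def Darts {n : ℕ} (ω : Sym2 (Fin n) → ℝ) (dst nxt : ℕ → ℕ) (wt : ℕ → ℝ) (K : ℕ) (v : Fin n) :
    ℕ → List (Fin n) → Prop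
  | h, [] => h = 0
  | h, u :: L => (0 < h ∧ h ≤ K) ∧ dst h = u ∧ wt h = ω s(v, u) ∧ Darts ω dst nxt wt K v (nxt h) L

/-- Loop rule for `forDarts`; the invariant speaks of the neighbours still to be visited. -/
lemma runs_forDarts {n : ℕ} {ω : Sym2 (Fin n) → ℝ} {v : Fin n} {K : ℕ} {body : Program} {m : Memory}
    {L : List (Fin n)} (hL : Darts ω (m.nat 5) (m.nat 6) (m.real 2) K v (m.reg 6) L)
    (J : List (Fin n) → Memory → Prop) (T : ℕ)
    (h₆ : 6 ∉ body.regs) (h₅' : 5 ∉ body.nats) (h₆' : 6 ∉ body.nats) (h₂ : 2 ∉ body.reals)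
    (hJ : ∀ L m k, J L m → J L (m.setReg 6 k)) (hinit : J L m)
    (hstep : ∀ (u : Fin n) L' (m' : Memory), u ∈ L →
      m'.nat 5 (m'.reg 6) = u → m'.real 2 (m'.reg 6) = ω s(v, u) →
      (forDarts body).Agree m m' → J (u :: L') m' → Runs body m' T (J L')) :
    Runs (forDarts body) m ((T + 6) * L.length + 3) (J []) := by
  refine Runs.loop (fun t m' => ∃ L', L' ⊆ L ∧ (forDarts body).Agree m m' ∧
    Darts ω (m.nat 5) (m.nat 6) (m.real 2) K v (m'.reg 6) L' ∧ J L' m' ∧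
    t = (T + 6) * L'.length + 3) ?_ ⟨L, List.Subset.refl _, .refl _ _, hL, hinit, rfl⟩
  rintro t m' ⟨L', hsub, ha, hD, hJ', rfl⟩
  have e5 : m'.nat 5 = m.nat 5 := ha.nat 5 (by simpa [forDarts, Program.nats] using h₅')
  have e2 : m'.real 2 = m.real 2 := ha.real 2 (by simpa [forDarts, Program.reals] using h₂)
  cases L' with
  | nil =>
    have h6 : m'.reg 6 = 0 := hD
    exact .inl ⟨by simp [Test.Holds, NExp.eval, h6], by simp [Test.cost, NExp.cost], hJ'⟩
  | cons u L' =>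
    right
    obtain ⟨hh, hd, hw, hD⟩ := hD
    refine ⟨by simpa [Test.Holds, NExp.eval] using hh.1, T + 3,
      (T + 6) * L'.length + 3, ?_, ?_⟩
    · simp only [Test.cost, NExp.cost, List.length_cons]
      ring_nf
      omega
    · refine Runs.seq (hstep u L' m' (hsub List.mem_cons_self) (by rw [e5, hd]) (by rw [e2, hw])
        ha hJ') (T₂ := 3) ?_ le_rfl
      intro m'' hb hJ''
      refine Runs.setReg ⟨L', fun x hx => hsub (List.mem_cons_of_mem _ hx), ?_, ?_,
        hJ _ _ _ hJ'', rfl⟩ le_rfl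
      · refine ha.trans (Program.Agree.trans (hb.mono ?_ ?_ ?_)
          ((Exec.setReg m'' 6 (.cell 6 (.reg 6))).agree.mono ?_ ?_ ?_)) <;>
          simp [forDarts, Program.regs, Program.nats, Program.reals]
      · have e6 : m''.nat 6 = m.nat 6 := (hb.nat 6 h₆').trans
          (ha.nat 6 (by simpa [forDarts, Program.nats] using h₆'))
        simpa [Memory.setReg, NExp.eval, e6, hb.reg 6 h₆] using hD

/-! ### Building the adjacency lists -/

section Build

variable {n : ℕ} {ω : Sym2 (Fin n) → ℝ}

/-- Adjacency lists with a neighbour `b` of `a` added in front. -/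
def addArc (adj : Fin n → List (Fin n)) (a b : Fin n) : Fin n → List (Fin n) :=
  Function.update adj a (b :: adj a)

/-- The adjacency lists of the graph with the given edges. -/
def adjOf : List (Fin n × Fin n) → Fin n → List (Fin n)
  | [] => fun _ => []
  | e :: l => addArc (addArc (adjOf l) e.1 e.2) e.2 e.1

lemma mem_addArc {adj : Fin n → List (Fin n)} {a b u v : Fin n} :
    u ∈ addArc adj a b v ↔ (v = a ∧ u = b) ∨ u ∈ adj v := by
  by_cases h : v = a
  · subst h
    simp [addArc]
  · simp [addArc, h]

lemma mem_adjOf {l : List (Fin n × Fin n)} {u v : Fin n} :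
    u ∈ adjOf l v ↔ s(v, u) ∈ l.map fun e => s(e.1, e.2) := by
  induction l with
  | nil => simp [adjOf]
  | cons e l ih =>
    rw [adjOf, mem_addArc, mem_addArc, ih, List.map_cons, List.mem_cons, Sym2.eq_iff]
    tauto

lemma nodup_adjOf {l : List (Fin n × Fin n)} (hl : (l.map fun e => s(e.1, e.2)).Nodup)
    (hne : ∀ e ∈ l, e.1 ≠ e.2) (v : Fin n) : (adjOf l v).Nodup := by
  induction l with
  | nil => simp [adjOf]
  | cons e l ih =>
    rw [List.map_cons, List.nodup_cons] at hl
    have hd := ih hl.2 fun e' he' => hne e' (List.mem_cons_of_mem _ he')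
    have h12 := hne e List.mem_cons_self
    have n1 : e.2 ∉ adjOf l e.1 := fun h => hl.1 (mem_adjOf.1 h)
    have n2 : e.1 ∉ adjOf l e.2 := fun h => hl.1 (by rw [Sym2.eq_swap]; exact mem_adjOf.1 h)
    by_cases h1 : v = e.1
    · subst h1
      simpa [adjOf, addArc, h12, n1] using hd
    · by_cases h2 : v = e.2
      · subst h2
        simpa [adjOf, addArc, h12.symm, n2] using hd
      · simpa [adjOf, addArc, h1, h2] using hd

lemma sum_length_addArc (adj : Fin n → List (Fin n)) (a b : Fin n) :
    ∑ v, (addArc adj a b v).length = ∑ v, (adj v).length + 1 := by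
  rw [← Finset.add_sum_erase _ _ (Finset.mem_univ a), ← Finset.add_sum_erase Finset.univ
    (fun v => (adj v).length) (Finset.mem_univ a)]
  rw [Finset.sum_congr rfl fun x hx => ?_]
  rotate_left
  · exact fun x => (adj x).length
  · simp [addArc, (Finset.mem_erase.1 hx).1]
  simp [addArc]
  omega

lemma sum_length_adjOf (l : List (Fin n × Fin n)) :
    ∑ v, (adjOf l v).length = 2 * l.length := by
  induction l with
  | nil => simp [adjOf]
  | cons e l ih =>
    rw [adjOf, sum_length_addArc, sum_length_addArc, ih, List.length_cons]
    ring

/-- Storing a new dart behind the last one does not affect the existing lists. -/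
lemma Darts.of_update {dst nxt : ℕ → ℕ} {wt : ℕ → ℝ} {K : ℕ} {v : Fin n} {h : ℕ}
    {L : List (Fin n)} (hL : Darts ω dst nxt wt K v h L) (x y : ℕ) (z : ℝ) :
    Darts ω (Function.update dst (K + 1) x) (Function.update nxt (K + 1) y)
      (Function.update wt (K + 1) z) (K + 1) v h L := by
  induction L generalizing h with
  | nil => exact hL
  | cons u L ih =>
    obtain ⟨hh, hd, hw, hL⟩ := hL
    have hne : h ≠ K + 1 := by omega
    refine ⟨⟨hh.1, by omega⟩, by simpa [hne] using hd, by simpa [hne] using hw, ?_⟩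
    rw [Function.update_of_ne hne]
    exact ih hL

/-- The memory holds the given adjacency lists and their lengths; register `8` holds the number
of darts. -/
def Built (ω : Sym2 (Fin n) → ℝ) (adj : Fin n → List (Fin n)) (m : Memory) : Prop :=
  ∀ v : Fin n, Darts ω (m.nat 5) (m.nat 6) (m.real 2) (m.reg 8) v (m.nat 4 v) (adj v) ∧
    m.nat 7 v = (adj v).length

/-- Add a dart for the edge whose number is in register `4`; arrays `p` and `q` hold its ends. -/
def addDart (p q : ℕ) : Program :=
  .seq (.setReg 8 (.succ (.reg 8))) <|
  .seq (.setNat 5 (.reg 8) (.cell q (.reg 4))) <|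
  .seq (.setReal 2 (.reg 8) (.cell 0 (.reg 4))) <|
  .seq (.setNat 6 (.reg 8) (.cell 4 (.cell p (.reg 4)))) <|
  .seq (.setNat 4 (.cell p (.reg 4)) (.reg 8))
    (.setNat 7 (.cell p (.reg 4)) (.succ (.cell 7 (.cell p (.reg 4)))))

lemma runs_addDart {p q : ℕ} (hp : p < 4) (hq : q < 4) {adj : Fin n → List (Fin n)} {m : Memory}
    (hm : Built ω adj m) {a b : Fin n} (ha : m.nat p (m.reg 4) = a) (hb : m.nat q (m.reg 4) = b)
    (hw : m.real 0 (m.reg 4) = ω s(a, b)) :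
    Runs (addDart p q) m 30 (Built ω (addArc adj a b)) := by
  have p4 : p ≠ 4 := by omega
  have p5 : p ≠ 5 := by omega
  have p6 : p ≠ 6 := by omega
  have p7 : p ≠ 7 := by omega
  have q4 : q ≠ 4 := by omega
  have q5 : q ≠ 5 := by omega
  have q6 : q ≠ 6 := by omega
  have q7 : q ≠ 7 := by omega
  refine Runs.straight rfl (by simp [addDart, Program.time, NExp.cost, RExp.cost]) ?_
  set m' := (addDart p q).run m with hm'
  have e8 : m'.reg 8 = m.reg 8 + 1 := by
    simp [hm', addDart, Program.run, Memory.setReg, Memory.setNat, Memory.setReal, NExp.eval,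
      RExp.eval]
  have e4 : m'.nat 4 = Function.update (m.nat 4) a (m.reg 8 + 1) := by
    simp [addDart, Program.run, Memory.setReg, Memory.setNat, Memory.setReal, NExp.eval,
      RExp.eval, *]
  have e5 : m'.nat 5 = Function.update (m.nat 5) (m.reg 8 + 1) b := by
    simp [addDart, Program.run, Memory.setReg, Memory.setNat, Memory.setReal, NExp.eval,
      RExp.eval, *]
  have e6 : m'.nat 6 = Function.update (m.nat 6) (m.reg 8 + 1) (m.nat 4 a) := by
    simp [addDart, Program.run, Memory.setReg, Memory.setNat, Memory.setReal, NExp.eval,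
      RExp.eval, *]
  have e7 : m'.nat 7 = Function.update (m.nat 7) a (m.nat 7 a + 1) := by
    simp [addDart, Program.run, Memory.setReg, Memory.setNat, Memory.setReal, NExp.eval,
      RExp.eval, *]
  have e2 : m'.real 2 = Function.update (m.real 2) (m.reg 8 + 1) (ω s(a, b)) := by
    simp [addDart, Program.run, Memory.setReg, Memory.setNat, Memory.setReal, NExp.eval,
      RExp.eval, *]
  intro v
  rw [e8, e4, e5, e6, e7, e2]
  by_cases hv : v = a
  · subst hv
    refine ⟨?_, by simp [addArc, (hm v).2]⟩
    simp only [addArc, Function.update_self, Darts]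
    exact ⟨by omega, trivial, trivial, (hm v).1.of_update _ _ _⟩
  · have hv' : (v : ℕ) ≠ a := fun h => hv (Fin.ext h)
    refine ⟨?_, by simp [addArc, (hm v).2, hv, hv']⟩
    simp only [addArc, Function.update_of_ne hv, Function.update_of_ne hv']
    exact (hm v).1.of_update _ _ _

/-- Build the adjacency lists from the list of edges. -/
def build : Program := forDown 1 (.seq (addDart 0 1) (addDart 1 0))

lemma runs_build {l : List (Fin n × Fin n)} {m : Memory} (h₁ : m.reg 1 = l.length)
    (he : ∀ i (h : i < l.length), m.nat 0 i = (l[i].1 : ℕ) ∧ m.nat 1 i = (l[i].2 : ℕ) ∧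
      m.real 0 i = ω s(l[i].1, l[i].2))
    (hz : Built ω (fun _ => []) m) :
    Runs build m (66 * l.length + 5) (Built ω (adjOf l)) := by
  refine (runs_forDown (fun i m' => Built ω (adjOf (l.drop i)) m') (fun _ => 60) (by decide)
    (fun i m' k h => by simpa [Built, Memory.setReg] using h)
    (by simpa [h₁, adjOf] using hz) ?_).weaken (by simp [h₁]; omega) (fun _ _ h => by simpa using h)
  intro i m' hi h4 ha hJ
  rw [h₁] at hi
  rw [List.drop_eq_getElem_cons hi, adjOf]
  obtain ⟨e0, e1, e2⟩ := he i hi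
  have f0 : m'.nat 0 = m.nat 0 := ha.nat 0 (by decide)
  have f1 : m'.nat 1 = m.nat 1 := ha.nat 1 (by decide)
  have f2 : m'.real 0 = m.real 0 := ha.real 0 (by decide)
  refine Runs.seq (runs_addDart (by omega) (by omega) hJ (a := l[i].1) (b := l[i].2)
    (by rw [h4, f0, e0]) (by rw [h4, f1, e1]) (by rw [h4, f2, e2])) (T₂ := 30) ?_ le_rfl
  intro m'' hb hJ'
  have g4 : m''.reg 4 = i := (hb.reg 4 (by decide)).trans h4
  refine runs_addDart (by omega) (by omega) hJ' ?_ ?_ ?_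
  · rw [g4, hb.nat 1 (by decide), f1, e1]
  · rw [g4, hb.nat 0 (by decide), f0, e0]
  · rw [g4, hb.real 0 (by decide), f2, e2, Sym2.eq_swap]

end Build

/-! ### Computing a perfect elimination order -/

section Peel

variable {n : ℕ} {G : SimpleGraph (Fin n)} [DecidableRel G.Adj]

/-- The state of the peeling: `R` is the set of remaining vertices, `deg` holds their degrees in
the graph induced on `R`, except that the vertices of `rem` still have to learn that one of their
neighbours was removed, and the queue `L` holds the vertices that once had degree at most two. -/
structure PeelState (G : SimpleGraph (Fin n)) [DecidableRel G.Adj] (deg : Fin n → ℕ)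
    (L : List (Fin n)) (R : Finset (Fin n)) (rem : List (Fin n)) : Prop where
  nodup : L.Nodup
  mem : ∀ v, v ∈ L ↔ deg v ≤ 2
  degree : ∀ w ∈ R, deg w = (R.filter (G.Adj w)).card + if w ∈ rem then 1 else 0

/-- A vertex enters the queue when its degree drops to two, which happens at most once. -/
lemma PeelState.step {deg : Fin n → ℕ} {L : List (Fin n)} {R : Finset (Fin n)} {u : Fin n}
    {rem : List (Fin n)} (h : PeelState G deg L R (u :: rem)) (hu : u ∉ rem) :
    PeelState G (Function.update deg u (deg u - 1)) (if deg u - 1 = 2 then L ++ [u] else L) R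
      rem where
  nodup := by
    split_ifs with h2
    · have : u ∉ L := fun hL => by
        have := (h.mem u).1 hL
        omega
      exact h.nodup.append (List.nodup_singleton u) (by simpa using this)
    · exact h.nodup
  mem v := by
    have hm := h.mem v
    by_cases hv : v = u
    · subst hv
      rw [Function.update_self]
      split_ifs with h2
      · simp [h2]
      · rw [hm]
        omega
    · rw [Function.update_of_ne hv]
      split_ifs with h2
      · simp [hv, hm]
      · exact hm
  degree w hw := by
    have hd := h.degree w hw
    by_cases hv : w = u
    · subst hv
      rw [Function.update_self, if_neg hu, hd]
      simp
    · rw [Function.update_of_ne hv, hd]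
      simp [hv]

/-- Removing a vertex from `R` leaves its neighbours, and only them, with an outdated degree. -/
lemma PeelState.pop {deg : Fin n → ℕ} {L : List (Fin n)} {R : Finset (Fin n)} {v : Fin n}
    {rem : List (Fin n)} (h : PeelState G deg L R []) (hv : v ∈ R)
    (hrem : ∀ u, u ∈ rem ↔ G.Adj v u) : PeelState G deg L (R.erase v) rem where
  nodup := h.nodup
  mem := h.mem
  degree w hw := by
    rw [h.degree w (Finset.mem_of_mem_erase hw), card_filter_adj_eq_erase_add hv w]
    simp [hrem]

/-- The first `i` vertices of the queue `L` have been removed, and `R` is the set of the others. -/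
structure Peeled (G : SimpleGraph (Fin n)) [DecidableRel G.Adj] (θ : Fin n → ℕ)
    (deg : Fin n → ℕ) (L : List (Fin n)) (R : Finset (Fin n)) (i : ℕ) : Prop where
  state : PeelState G deg L R []
  le : i ≤ L.length
  remaining : ∀ v, v ∈ R ↔ v ∉ L.take i
  saturated : Saturated G θ R
  elimination : ∀ M, (∀ x ∈ M, x ∈ R) → IsEliminationOrder G M →
    IsEliminationOrder G (L.take i ++ M)

variable {θ : Fin n → ℕ} {deg deg' : Fin n → ℕ} {L L' : List (Fin n)} {R : Finset (Fin n)} {i : ℕ}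

lemma Peeled.getElem_mem (h : Peeled G θ deg L R i) (hi : i < L.length) : L[i] ∈ R := by
  rw [h.remaining]
  intro hmem
  obtain ⟨j, hj, hji⟩ := List.mem_take_iff_getElem.1 hmem
  have := (h.state.nodup.getElem_inj_iff).1 hji
  omega

lemma Peeled.degree_le_two (h : Peeled G θ deg L R i) (hi : i < L.length) :
    (R.filter (G.Adj L[i])).card ≤ 2 := by
  have := h.state.degree _ (h.getElem_mem hi)
  have := (h.state.mem _).1 (List.getElem_mem hi)
  simp_all

lemma Peeled.succ (hθ : Function.Injective θ) (hn : NonCrossing G θ) (h : Peeled G θ deg L R i)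
    (hi : i < L.length) (h' : PeelState G deg' L' (R.erase L[i]) []) (hL : L <+: L') :
    Peeled G θ deg' L' (R.erase L[i]) (i + 1) := by
  obtain ⟨E, rfl⟩ := hL
  have htake : (L ++ E).take (i + 1) = L.take i ++ [L[i]] := by
    rw [List.take_append_of_le_length (by omega), List.take_add_one, List.getElem?_eq_getElem hi]
    rfl
  have hd := h.degree_le_two hi
  refine ⟨h', by simp; omega, fun v => ?_, h.saturated.erase hθ hn (h.getElem_mem hi) hd,
    fun M hM hMe => ?_⟩
  · rw [htake, Finset.mem_erase, h.remaining, List.mem_append, List.mem_singleton]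
    tauto
  · rw [htake, List.append_assoc]
    refine h.elimination _ ?_ ⟨fun hmem => ?_, fun a ha b hb hva hvb hab => ?_, hMe⟩
    · intro x hx
      rcases List.mem_cons.1 hx with rfl | hx
      · exact h.getElem_mem hi
      · exact Finset.mem_of_mem_erase (hM x hx)
    · exact (Finset.mem_erase.1 (hM _ hmem)).1 rfl
    · exact h.saturated.adj_of_degree_le_two hθ hn hd (Finset.mem_of_mem_erase (hM a ha))
        (Finset.mem_of_mem_erase (hM b hb)) hva hvb hab

/-- The queue does not run empty before all vertices are removed. -/
lemma Peeled.complete (hθ : Function.Injective θ) (hn : NonCrossing G θ)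
    (h : Peeled G θ deg L R L.length) : L.Nodup ∧ (∀ v, v ∈ L) ∧ IsEliminationOrder G L := by
  have hR : ¬ R.Nonempty := by
    intro hR
    obtain ⟨x, hx, hd⟩ := hn.exists_degree_le_two hθ hR
    have h1 := h.state.degree x hx
    have h2 := (h.remaining x).1 hx
    rw [List.take_length, h.state.mem] at h2
    simp only [List.not_mem_nil, if_false] at h1
    omega
  refine ⟨h.state.nodup, fun v => ?_, by simpa using h.elimination [] (by simp) trivial⟩
  by_contra hv
  exact hR ⟨v, (h.remaining v).2 (by simpa using hv)⟩

/-- The memory holds the list `L` in integer array `8`. -/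
def HoldsOrder (L : List (Fin n)) (m : Memory) : Prop :=
  ∀ i (h : i < L.length), m.nat 8 i = (L[i] : ℕ)

/-- The memory holds the queue `L`, with its length in register `7`. -/
def HoldsQueue (L : List (Fin n)) (m : Memory) : Prop :=
  m.reg 7 = L.length ∧ HoldsOrder L m

lemma HoldsQueue.push {m m' : Memory} {u : Fin n} (h : HoldsQueue L m)
    (h7 : m'.reg 7 = m.reg 7 + 1) (h8 : m'.nat 8 = Function.update (m.nat 8) (m.reg 7) u) :
    HoldsQueue (L ++ [u]) m' := by
  refine ⟨by simp [h7, h.1], fun i hi => ?_⟩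
  rw [h8, h.1]
  by_cases hiL : i < L.length
  · rw [Function.update_of_ne (by omega), List.getElem_append_left hiL]
    exact h.2 i hiL
  · have : i = L.length := by
      simp at hi
      omega
    subst this
    simp

lemma HoldsQueue.congr {m m' : Memory} (h : HoldsQueue L m) (h7 : m'.reg 7 = m.reg 7)
    (h8 : m'.nat 8 = m.nat 8) : HoldsQueue L m' :=
  ⟨h7.trans h.1, fun i hi => by rw [h8]; exact h.2 i hi⟩

/-- Append a vertex to the queue. -/
def pushVertex (e : NExp) : Program :=
  .seq (.setNat 8 (.reg 7) e) (.setReg 7 (.succ (.reg 7)))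

/-- Fill the queue with the vertices of degree at most two. -/
def initQueue : Program :=
  .seq (.setReg 7 (.const 0))
    (forUp (.branch (.natLt (.cell 7 (.reg 4)) (.const 3)) (pushVertex (.reg 4)) .skip))

lemma runs_initQueue {m : Memory} (h₀ : m.reg 0 = n) (hdeg : ∀ v : Fin n, m.nat 7 v = deg v) :
    Runs initQueue m (30 * n + 10) fun m' =>
      ∃ L, HoldsQueue L m' ∧ L.Nodup ∧ ∀ v, v ∈ L ↔ deg v ≤ 2 := by
  refine Runs.seq (Q₁ := fun m' => m'.reg 7 = 0) (T₁ := 2) (T₂ := 30 * n + 5)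
    (Runs.setReg (by simp [Memory.setReg, NExp.eval]) le_rfl) ?_ (by omega)
  intro m₁ ha₁ h7
  have h₀₁ : m₁.reg 0 = n := (ha₁.reg 0 (by decide)).trans h₀
  refine (runs_forUp (fun i m' => ∃ L, HoldsQueue L m' ∧ L.Nodup ∧
    ∀ v : Fin n, v ∈ L ↔ (v : ℕ) < i ∧ deg v ≤ 2) (fun _ => 24) (by decide) (by decide) ?_ ?_
    ?_).weaken (by simp [h₀₁]; omega) ?_
  · rintro i m' k ⟨L, hL, h⟩
    exact ⟨L, hL.congr (by simp [Memory.setReg]) rfl, h⟩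
  · exact ⟨[], ⟨h7, by simp [HoldsOrder]⟩, by simp⟩
  · rintro i m' hi h4 ha ⟨L, hL, hnd, hmem⟩
    rw [h₀₁] at hi
    have e7 : m'.nat 7 i = deg ⟨i, hi⟩ := by
      rw [ha.nat 7 (by decide), ha₁.nat 7 (by decide)]
      exact hdeg ⟨i, hi⟩
    refine Runs.straight rfl (by decide) ?_
    have hlt : (Test.natLt (.cell 7 (.reg 4)) (.const 3)).Holds m' ↔ deg ⟨i, hi⟩ ≤ 2 := by
      simp only [Test.Holds, NExp.eval, h4, e7]
      omega
    by_cases h2 : deg ⟨i, hi⟩ ≤ 2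
    · rw [Program.run_branch_of_holds (hlt.2 h2)]
      refine ⟨L ++ [⟨i, hi⟩], hL.push ?_ ?_, ?_, fun v => ?_⟩
      · simp [pushVertex, Program.run, Memory.setReg, Memory.setNat, NExp.eval]
      · simp [pushVertex, Program.run, Memory.setReg, Memory.setNat, NExp.eval, h4]
      · exact hnd.append (List.nodup_singleton _) (by simp [hmem])
      · simp only [List.mem_append, List.mem_singleton, hmem, Fin.ext_iff]
        constructor
        · rintro (h | h)
          · omega
          · obtain rfl : v = ⟨i, hi⟩ := Fin.ext h
            exact ⟨by simp, h2⟩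
        · intro h
          omega
    · rw [Program.run_branch_of_not_holds fun h => h2 (hlt.1 h)]
      refine ⟨L, hL, hnd, fun v => ?_⟩
      rw [hmem]
      have : (v : ℕ) = i → ¬ deg v ≤ 2 := fun h => by
        obtain rfl : v = ⟨i, hi⟩ := Fin.ext h
        exact h2
      constructor
      · intro h
        omega
      · intro h
        refine ⟨?_, h.2⟩
        by_contra hv
        exact this (by omega) h.2
  · rintro m' - ⟨L, hL, hnd, hmem⟩
    refine ⟨L, hL, hnd, fun v => ?_⟩
    rw [hmem, h₀₁]
    simp

/-- Lower the degree of the end of the current dart. -/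
def lowerDegree : Program :=
  .seq (.setNat 7 (.cell 5 (.reg 6)) (.pred (.cell 7 (.cell 5 (.reg 6)))))
    (.branch (.natEq (.cell 7 (.cell 5 (.reg 6))) (.const 2)) (pushVertex (.cell 5 (.reg 6))) .skip)

/-- Remove the vertices in the queue one after the other. -/
def peel : Program :=
  .seq (.setReg 4 (.const 0))
    (.loop (.natLt (.reg 4) (.reg 7))
      (.seq (.setReg 6 (.cell 4 (.cell 8 (.reg 4))))
        (.seq (forDarts lowerDegree) (.setReg 4 (.succ (.reg 4))))))

/-- The program `lowerDegree` carries out the step `PeelState.step`. -/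
lemma runs_lowerDegree {m : Memory} {u : Fin n} {rem : List (Fin n)}
    (hdeg : ∀ v : Fin n, m.nat 7 v = deg v) (hL : HoldsQueue L m)
    (hs : PeelState G deg L R (u :: rem)) (hu : u ∉ rem) (h5 : m.nat 5 (m.reg 6) = u) :
    Runs lowerDegree m 30 fun m' => ∃ deg' L', (∀ v : Fin n, m'.nat 7 v = deg' v) ∧
      HoldsQueue L' m' ∧ L <+: L' ∧ PeelState G deg' L' R rem := by
  set m₁ := m.setNat 7 u (deg u - 1) with hm₁
  have h5' : m₁.nat 5 (m₁.reg 6) = u := by simpa [hm₁, Memory.setNat] using h5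
  have hrun : lowerDegree.run m
      = if deg u - 1 = 2 then (pushVertex (.cell 5 (.reg 6))).run m₁ else m₁ := by
    have h1 : (Program.setNat 7 (.cell 5 (.reg 6)) (.pred (.cell 7 (.cell 5 (.reg 6))))).run m
        = m₁ := by
      simp only [Program.run, NExp.eval]
      rw [h5, hdeg]
    rw [lowerDegree, Program.run_seq, h1]
    have htest : (Test.natEq (.cell 7 (.cell 5 (.reg 6))) (.const 2)).Holds m₁ ↔ deg u - 1 = 2 := by
      simp only [Test.Holds, NExp.eval, h5']
      simp [hm₁, Memory.setNat]
    by_cases h2 : deg u - 1 = 2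
    · rw [Program.run_branch_of_holds (htest.2 h2), if_pos h2]
    · rw [Program.run_branch_of_not_holds fun h => h2 (htest.1 h), if_neg h2]
      rfl
  refine Runs.straight rfl (by decide) ⟨_, _, ?_, ?_, ?_, hs.step hu⟩
  · intro v
    have : (lowerDegree.run m).nat 7 = Function.update (m.nat 7) u (deg u - 1) := by
      rw [hrun]
      split_ifs <;> simp [pushVertex, Program.run, Memory.setReg, Memory.setNat, hm₁]
    rw [this]
    by_cases hv : v = u
    · subst hv
      simp
    · have hv' : (v : ℕ) ≠ u := fun h => hv (Fin.ext h)
      simp [hv, hv', hdeg]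
  · rw [hrun]
    split_ifs with h2
    · apply hL.push <;>
        simp [pushVertex, Program.run, Memory.setReg, Memory.setNat, NExp.eval, hm₁, h5]
    · exact hL.congr rfl (by simp [hm₁, Memory.setNat])
  · split_ifs
    · exact List.prefix_append _ _
    · exact List.prefix_refl _

/-- The peeling leaves a perfect elimination order in the queue.  Every vertex is removed once, in
time proportional to its degree, so the time that is left is accounted to the remaining vertices. -/
lemma runs_peel {ω : Sym2 (Fin n) → ℝ} {adj : Fin n → List (Fin n)} {K : ℕ} {m : Memory}
    (hθ : Function.Injective θ) (hn : NonCrossing G θ) (hsat : Saturated G θ Finset.univ)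
    (hadj : ∀ u v, u ∈ adj v ↔ G.Adj v u) (hnd : ∀ v, (adj v).Nodup)
    (hD : ∀ v : Fin n, Darts ω (m.nat 5) (m.nat 6) (m.real 2) K v (m.nat 4 v) (adj v))
    (hdeg : ∀ v : Fin n, m.nat 7 v = deg v) (hdeg' : ∀ v, deg v = (adj v).length)
    (hL : HoldsQueue L m) (hLnd : L.Nodup) (hmem : ∀ v, v ∈ L ↔ deg v ≤ 2) :
    Runs peel m (36 * ∑ v, (adj v).length + 20 * n + 10) fun m' =>
      ∃ L, HoldsOrder L m' ∧ L.Nodup ∧ (∀ v, v ∈ L) ∧ IsEliminationOrder G L := by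
  refine Runs.seq (Q₁ := fun m' => m'.reg 4 = 0) (T₁ := 2)
    (T₂ := 36 * ∑ v, (adj v).length + 20 * n + 8)
    (Runs.setReg (by simp [Memory.setReg, NExp.eval]) le_rfl) ?_ (by omega)
  intro m₁ ha₁ h4
  refine Runs.loop (fun t m' => ∃ deg L R i, Peeled G θ deg L R i ∧ m'.reg 4 = i ∧
    (∀ v : Fin n, m'.nat 7 v = deg v) ∧ HoldsQueue L m' ∧ peel.Agree m m' ∧
    t = ∑ v ∈ R, (36 * (adj v).length + 16) + 8) ?_ (T := ∑ v, (36 * (adj v).length + 16) + 8)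
    ⟨deg, L, Finset.univ, 0, ⟨⟨hLnd, hmem, fun w _ => ?_⟩, by simp, by simp, hsat, by simp⟩, h4, ?_,
      ?_, ?_, rfl⟩ |>.weaken ?_ fun _ _ h => h
  · rintro t m' ⟨deg, L, R, i, hP, h4, hdeg, hL, ha, rfl⟩
    rcases hP.le.lt_or_eq with hi | rfl
    · right
      have hv := hP.getElem_mem hi
      set v := L[i] with hvi
      refine ⟨by simpa [Test.Holds, NExp.eval, h4, hL.1] using hi, 36 * (adj v).length + 13,
        ∑ v ∈ R.erase v, (36 * (adj v).length + 16) + 8, ?_, ?_⟩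
      · rw [← Finset.add_sum_erase _ _ hv]
        simp only [Test.cost, NExp.cost]
        omega
      have e4 : m'.nat 4 = m.nat 4 := ha.nat 4 (by decide)
      refine Runs.seq (Q₁ := fun m'' => m'' = m'.setReg 6 (m.nat 4 v)) (T₁ := 4)
        (T₂ := 36 * (adj v).length + 6) (Runs.setReg ?_ le_rfl) ?_ (by omega)
      · simp [NExp.eval, h4, hL.2 i hi, e4, hvi]
      rintro m₂ hc rfl
      have hc' : peel.Agree m (m'.setReg 6 (m.nat 4 v)) :=
        ha.trans (hc.mono (by decide) (by decide) (by decide))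
      refine Runs.seq (T₁ := 36 * (adj v).length + 3) (T₂ := 3)
        (runs_forDarts (ω := ω) (v := v) (K := K) (L := adj v) ?_
          (fun rem m'' => ∃ deg' L', rem.Nodup ∧ (∀ v : Fin n, m''.nat 7 v = deg' v) ∧
            HoldsQueue L' m'' ∧ L <+: L' ∧ PeelState G deg' L' (R.erase v) rem) 30
          (by decide) (by decide) (by decide) (by decide) ?_ ?_ ?_) ?_ (by omega)
      · have := hD v
        simpa [Memory.setReg, hc'.nat 5 (by decide), hc'.nat 6 (by decide),
          hc'.real 2 (by decide), ha.nat 5 (by decide), ha.nat 6 (by decide),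
          ha.real 2 (by decide)] using this
      · rintro rem m'' k ⟨deg', L', h1, h2, h3, h5⟩
        exact ⟨deg', L', h1, h2, h3.congr (by simp [Memory.setReg]) rfl, h5⟩
      · exact ⟨deg, L, hnd v, hdeg, hL.congr (by simp [Memory.setReg]) rfl, List.prefix_refl _,
          hP.state.pop hv fun u => hadj u v⟩
      · rintro u rem m'' - h5 - - ⟨deg', L', h1, h2, h3, h6, h7⟩
        rw [List.nodup_cons] at h1
        refine (runs_lowerDegree h2 h3 h7 h1.1 h5).weaken le_rfl ?_
        rintro m₃ - ⟨deg'', L'', k1, k2, k3, k4⟩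
        exact ⟨deg'', L'', h1.2, k1, k2, h6.trans k3, k4⟩
      · rintro m₃ hd ⟨deg', L', -, h2, h3, h6, h7⟩
        have f4 : m₃.reg 4 = i := by
          rw [hd.reg 4 (by decide)]
          simpa [Memory.setReg] using h4
        refine Runs.setReg ⟨deg', L', R.erase v, i + 1, hP.succ hθ hn hi h7 h6, ?_, h2,
          h3.congr (by simp [Memory.setReg]) rfl, ?_, rfl⟩ le_rfl
        · simp [Memory.setReg, NExp.eval, f4]
        · exact (hc'.trans (hd.mono (by decide) (by decide) (by decide))).trans
            ((Exec.setReg m₃ 4 (.succ (.reg 4))).agree.mono (by decide) (by decide) (by decide))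
    · left
      exact ⟨by simp [Test.Holds, NExp.eval, h4, hL.1], by simp [Test.cost, NExp.cost],
        L, hL.2, hP.complete hθ hn⟩
  · rw [hdeg', ← List.toFinset_card_of_nodup (hnd w)]
    simp only [List.not_mem_nil, if_false, add_zero]
    congr 1
    ext u
    simp [hadj]
  · intro v
    rw [ha₁.nat 7 (by decide), hdeg]
  · exact hL.congr (ha₁.reg 7 (by decide)) (ha₁.nat 8 (by decide))
  · exact ha₁.mono (by decide) (by decide) (by decide)
  · rw [Finset.sum_add_distrib, ← Finset.mul_sum]
    simp
    omega

end Peel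

/-! ### Passes over all darts in elimination order -/

section Passes

variable {n : ℕ} {ω : Sym2 (Fin n) → ℝ} {adj : Fin n → List (Fin n)} {K : ℕ} {L : List (Fin n)}

/-- The memory holds the adjacency lists `adj` and the elimination order `L`. -/
structure HoldsGraph (ω : Sym2 (Fin n) → ℝ) (adj : Fin n → List (Fin n)) (K : ℕ)
    (L : List (Fin n)) (m : Memory) : Prop where
  size : m.reg 0 = n
  darts : ∀ v : Fin n, Darts ω (m.nat 5) (m.nat 6) (m.real 2) K v (m.nat 4 v) (adj v)
  order : HoldsOrder L m

/-- The program leaves the registers of the passes and the representation of the graph alone. -/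
structure Program.Safe (c : Program) : Prop where
  regs : ∀ k ∈ c.regs, k ∉ [0, 4, 5, 6]
  nats : ∀ k ∈ c.nats, k ∉ [4, 5, 6, 8]
  reals : 2 ∉ c.reals

lemma HoldsGraph.of_agree {c : Program} {m m' : Memory} (h : HoldsGraph ω adj K L m)
    (ha : c.Agree m m') (h₀ : 0 ∉ c.regs) (hn : ∀ k ∈ c.nats, k ∉ [4, 5, 6, 8])
    (h₂ : 2 ∉ c.reals) : HoldsGraph ω adj K L m' where
  size := (ha.reg 0 h₀).trans h.size
  darts v := by
    rw [ha.nat 4 fun hk => hn 4 hk (by simp), ha.nat 5 fun hk => hn 5 hk (by simp),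
      ha.nat 6 fun hk => hn 6 hk (by simp), ha.real 2 h₂]
    exact h.darts v
  order i hi := by
    rw [ha.nat 8 fun hk => hn 8 hk (by simp)]
    exact h.order i hi

/-- Execution of `body` for all darts from the vertex at the place of the order that register `4`
holds, with this vertex in register `5` and the dart in register `6`. -/
def visit (body : Program) : Program :=
  .seq (.setReg 5 (.cell 8 (.reg 4))) (.seq (.setReg 6 (.cell 4 (.reg 5))) (forDarts body))

/-- All pairs of a vertex of the list and one of its neighbours. -/
def arcs (adj : Fin n → List (Fin n)) (L : List (Fin n)) : List (Fin n × Fin n) :=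
  L.flatMap fun v => (adj v).map fun u => (v, u)

lemma arcs_cons (v : Fin n) (L : List (Fin n)) :
    arcs adj (v :: L) = (adj v).map (fun u => (v, u)) ++ arcs adj L := by
  simp [arcs]

lemma runs_visit {body : Program} {m : Memory} (hm : HoldsGraph ω adj K L m) (hb : body.Safe)
    {v : Fin n} (hv : m.nat 8 (m.reg 4) = v) (J : List (Fin n × Fin n) → Memory → Prop) (T : ℕ)
    (hJ : ∀ E m r k, r ∈ [4, 5, 6] → J E m → J E (m.setReg r k))
    {E : List (Fin n × Fin n)} (hinit : J ((adj v).map (fun u => (v, u)) ++ E) m)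
    (hstep : ∀ (v u : Fin n) E (m' : Memory), u ∈ adj v → HoldsGraph ω adj K L m' →
      m'.reg 5 = v → m'.nat 5 (m'.reg 6) = u → m'.real 2 (m'.reg 6) = ω s(v, u) →
      J ((v, u) :: E) m' → Runs body m' T (J E)) :
    Runs (visit body) m ((T + 6) * (adj v).length + 10) (J E) := by
  set m₁ := (m.setReg 5 v).setReg 6 (m.nat 4 v) with hm₁
  have hsub : ∀ {k}, k ∉ [4, 5, 6] → k ∉ body.regs → k ∉ (visit body).regs := by
    intro k hk hk'
    simp only [List.mem_cons, List.not_mem_nil, or_false, not_or] at hk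
    simp [visit, forDarts, Program.regs, hk, hk']
  refine Runs.seq (Q₁ := fun m' => m' = m.setReg 5 v) (T₁ := 4)
    (T₂ := (T + 6) * (adj v).length + 6) (Runs.setReg (by simp [NExp.eval, hv]) (by decide)) ?_
    (by omega)
  rintro _ - rfl
  refine Runs.seq (Q₁ := fun m' => m' = m₁) (T₁ := 3)
    (T₂ := (T + 6) * (adj v).length + 3)
    (Runs.setReg (by simp [NExp.eval, hm₁, Memory.setReg]) le_rfl) ?_ (by omega)
  rintro _ - rfl
  have hg : HoldsGraph ω adj K L m₁ :=
    ⟨by simpa [hm₁, Memory.setReg] using hm.size, hm.darts, hm.order⟩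
  have h5 : m₁.reg 5 = v := by simp [hm₁, Memory.setReg]
  have nm : ∀ {k}, k ∈ [0, 4, 5, 6] → k ∉ body.regs := fun hk hk' => hb.regs _ hk' hk
  have nn : ∀ {k}, k ∈ [4, 5, 6, 8] → k ∉ body.nats := fun hk hk' => hb.nats _ hk' hk
  refine (runs_forDarts (v := v) (ω := ω) (K := K) (L := adj v)
    (by simpa [hm₁, Memory.setReg] using hm.darts v)
    (fun rem m' => J (rem.map (fun u => (v, u)) ++ E) m') T (nm (by simp)) (nn (by simp))
    (nn (by simp)) hb.reals (fun rem m' k h => hJ _ _ _ _ (by simp) h) ?_ ?_).weaken le_rfl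
    (fun _ _ h => h)
  · exact hJ _ _ _ _ (by simp) (hJ _ _ _ _ (by simp) hinit)
  · intro u rem m' hu hd hw ha hJ'
    have ha' : m'.reg 5 = m₁.reg 5 := ha.reg 5 (by
      simpa [forDarts, Program.regs] using nm (k := 5) (by simp))
    refine hstep v u _ m' hu (hg.of_agree ha ?_ ?_ ?_) (ha'.trans h5) hd hw hJ'
    · simpa [forDarts, Program.regs] using nm (k := 0) (by simp)
    · simpa [forDarts, Program.nats] using hb.nats
    · simpa [forDarts, Program.reals] using hb.reals

lemma sum_range_getElem?_elim {α : Type*} (f : α → ℕ) (l : List α) :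
    ∑ i ∈ Finset.range l.length, l[i]?.elim 0 f = (l.map f).sum := by
  induction l with
  | nil => simp
  | cons a l ih =>
    rw [List.length_cons, Finset.sum_range_succ']
    simp [ih, add_comm]

lemma sum_map_eq_sum_univ (f : Fin n → ℕ) (hnd : L.Nodup) (hmem : ∀ v, v ∈ L) :
    (L.map f).sum = ∑ v, f v := by
  rw [← List.sum_toFinset f hnd]
  congr 1
  ext v
  simp [hmem]

lemma length_eq_of_nodup (hnd : L.Nodup) (hmem : ∀ v, v ∈ L) : L.length = n := by
  rw [← List.toFinset_card_of_nodup hnd]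
  have : L.toFinset = Finset.univ := by
    ext v
    simp [hmem]
  simp [this]

/-- The number of steps of one pass. -/
lemma sum_time_visit (T : ℕ) (hnd : L.Nodup) (hmem : ∀ v, v ∈ L) :
    ∑ i ∈ Finset.range n, ((L[i]?.elim 0 fun v => (T + 6) * (adj v).length + 10) + 6) + 5
      = (T + 6) * ∑ v, (adj v).length + 16 * n + 5 := by
  rw [Finset.sum_add_distrib]
  have := sum_range_getElem?_elim (fun v => (T + 6) * (adj v).length + 10) L
  rw [length_eq_of_nodup hnd hmem, sum_map_eq_sum_univ _ hnd hmem, Finset.sum_add_distrib,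
    ← Finset.mul_sum] at this
  rw [this]
  simp
  ring

/-- Rule for a pass over all darts; the invariant speaks of the darts still to be visited. -/
lemma runs_forUp_visit {body : Program} {m : Memory} (hm : HoldsGraph ω adj K L m)
    (hb : body.Safe) (hnd : L.Nodup) (hmem : ∀ v, v ∈ L)
    (J : List (Fin n × Fin n) → Memory → Prop) (T : ℕ)
    (hJ : ∀ E m r k, r ∈ [4, 5, 6] → J E m → J E (m.setReg r k)) (hinit : J (arcs adj L) m)
    (hstep : ∀ (v u : Fin n) E (m' : Memory), u ∈ adj v → HoldsGraph ω adj K L m' →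
      m'.reg 5 = v → m'.nat 5 (m'.reg 6) = u → m'.real 2 (m'.reg 6) = ω s(v, u) →
      J ((v, u) :: E) m' → Runs body m' T (J E)) :
    Runs (forUp (visit body)) m ((T + 6) * ∑ v, (adj v).length + 16 * n + 5) (J []) := by
  have hlen := length_eq_of_nodup hnd hmem
  have nm : ∀ {k}, k ∈ [0, 4, 5, 6] → k ∉ body.regs := fun hk hk' => hb.regs _ hk' hk
  refine (runs_forUp (fun i m' => J (arcs adj (L.drop i)) m')
    (fun i => L[i]?.elim 0 fun v => (T + 6) * (adj v).length + 10) ?_ ?_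
    (fun i m' k h => hJ _ _ _ _ (by simp) h) (by simpa using hinit) ?_).weaken ?_ ?_
  · simpa [visit, forDarts, Program.regs] using nm (k := 0) (by simp)
  · simpa [visit, forDarts, Program.regs] using nm (k := 4) (by simp)
  · intro i m' hi h4 ha hJ'
    rw [hm.size, ← hlen] at hi
    rw [List.getElem?_eq_getElem hi]
    have hg : HoldsGraph ω adj K L m' := hm.of_agree ha
      (by simpa [forUp, visit, forDarts, Program.regs] using nm (k := 0) (by simp))
      (by simpa [forUp, visit, forDarts, Program.nats] using hb.nats)
      (by simpa [forUp, visit, forDarts, Program.reals] using hb.reals)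
    refine runs_visit hg hb (by rw [h4]; exact hg.order i hi) J T hJ ?_ hstep
    rwa [List.drop_eq_getElem_cons hi, arcs_cons] at hJ'
  · rw [hm.size]
    exact (sum_time_visit T hnd hmem).le
  · intro m' _ h
    rw [hm.size, List.drop_of_length_le hlen.le] at h
    exact h

lemma runs_forDown_visit {body : Program} {m : Memory} (hm : HoldsGraph ω adj K L m)
    (hb : body.Safe) (hnd : L.Nodup) (hmem : ∀ v, v ∈ L)
    (J : List (Fin n × Fin n) → Memory → Prop) (T : ℕ)
    (hJ : ∀ E m r k, r ∈ [4, 5, 6] → J E m → J E (m.setReg r k))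
    (hinit : J (arcs adj L.reverse) m)
    (hstep : ∀ (v u : Fin n) E (m' : Memory), u ∈ adj v → HoldsGraph ω adj K L m' →
      m'.reg 5 = v → m'.nat 5 (m'.reg 6) = u → m'.real 2 (m'.reg 6) = ω s(v, u) →
      J ((v, u) :: E) m' → Runs body m' T (J E)) :
    Runs (forDown 0 (visit body)) m ((T + 6) * ∑ v, (adj v).length + 16 * n + 5) (J []) := by
  have hlen := length_eq_of_nodup hnd hmem
  have nm : ∀ {k}, k ∈ [0, 4, 5, 6] → k ∉ body.regs := fun hk hk' => hb.regs _ hk' hk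
  refine (runs_forDown (fun i m' => J (arcs adj (L.take i).reverse) m')
    (fun i => L[i]?.elim 0 fun v => (T + 6) * (adj v).length + 10) ?_
    (fun i m' k h => hJ _ _ _ _ (by simp) h) (by simpa [hm.size, ← hlen] using hinit) ?_).weaken
    ?_ ?_
  · simpa [visit, forDarts, Program.regs] using nm (k := 4) (by simp)
  · intro i m' hi h4 ha hJ'
    rw [hm.size, ← hlen] at hi
    rw [List.getElem?_eq_getElem hi]
    have hg : HoldsGraph ω adj K L m' := hm.of_agree ha
      (by simpa [forDown, visit, forDarts, Program.regs] using nm (k := 0) (by simp))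
      (by simpa [forDown, visit, forDarts, Program.nats] using hb.nats)
      (by simpa [forDown, visit, forDarts, Program.reals] using hb.reals)
    refine runs_visit hg hb (by rw [h4]; exact hg.order i hi) J T hJ ?_ hstep
    rwa [List.take_add_one, List.getElem?_eq_getElem hi, Option.toList_some, List.reverse_append,
      List.reverse_singleton, List.singleton_append, arcs_cons] at hJ'
  · rw [hm.size]
    exact (sum_time_visit T hnd hmem).le
  · intro m' _ h
    simpa [arcs] using h

/-! ### Sweeps -/

/-- The extended real number that is stored in cell `v` of real array `A`, with a flag for
finiteness in integer array `F`. -/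
noncomputable def Memory.value (F A : ℕ) (m : Memory) (v : ℕ) : EReal :=
  if m.nat F v = 0 then ⊤ else (m.real A v : EReal)

/-- Relaxation along the current dart, from the vertex `x` to the vertex `y`. -/
def relaxDart (F A : ℕ) (x y : NExp) : Program :=
  .branch (.conj (.neg (.natEq (.cell F x) (.const 0)))
      (.neg (.conj (.neg (.natEq (.cell F y) (.const 0)))
        (.neg (.realLt (.plus (.cell A x) (.cell 2 (.reg 6))) (.cell A y))))))
    (.seq (.setNat F y (.const 1)) (.setReal A y (.plus (.cell A x) (.cell 2 (.reg 6))))) .skip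

/-- The vertex in register `5`. -/
def tail : NExp := .reg 5

/-- The end of the dart in register `6`. -/
def head : NExp := .cell 5 (.reg 6)

/-- The program `relaxDart` carries out one relaxation; a vanishing flag stands for `⊤`. -/
lemma runs_relaxDart {F A : ℕ} (hF : F ∉ [4, 5, 6, 8]) {x y : NExp}
    (hx : x = tail ∧ y = head ∨ x = head ∧ y = tail) {m : Memory} {a b : Fin n}
    (ha : x.eval m = a) (hb : y.eval m = b) (hw : m.real 2 (m.reg 6) = ω s(a, b))
    {f : Fin n → EReal} (hf : ∀ v : Fin n, m.value F A v = f v) :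
    Runs (relaxDart F A x y) m 60 fun m' => ∀ v : Fin n, m'.value F A v = relax ω f (a, b) v := by
  have hF5 : F ≠ 5 := fun h => hF (by simp [h])
  refine Runs.straight rfl ?_ ?_
  · rcases hx with ⟨rfl, rfl⟩ | ⟨rfl, rfl⟩ <;>
      simp [relaxDart, tail, head, Program.time, Test.cost, NExp.cost, RExp.cost]
  have htest : ∀ t : Test, t = (Test.conj (.neg (.natEq (.cell F x) (.const 0)))
      (.neg (.conj (.neg (.natEq (.cell F y) (.const 0)))
        (.neg (.realLt (.plus (.cell A x) (.cell 2 (.reg 6))) (.cell A y)))))) →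
      (t.Holds m ↔ (m.nat F a ≠ 0 ∧
        ¬ (m.nat F b ≠ 0 ∧ ¬ m.real A a + ω s(a, b) < m.real A b))) := by
    rintro _ rfl
    simp only [Test.Holds, NExp.eval, RExp.eval, ha, hb, hw, ne_eq]
  have hfa := hf a
  have hfb := hf b
  rw [Memory.value] at hfa hfb
  rw [relaxDart]
  by_cases h : m.nat F a ≠ 0 ∧ ¬ (m.nat F b ≠ 0 ∧ ¬ m.real A a + ω s(a, b) < m.real A b)
  · rw [Program.run_branch_of_holds ((htest _ rfl).2 h)]
    set m₁ := m.setNat F b 1 with hm₁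
    have h1 : (Program.setNat F y (.const 1)).run m = m₁ := by
      simp only [Program.run, NExp.eval, hb, hm₁]
    have hxy : x.eval m₁ = x.eval m ∧ y.eval m₁ = y.eval m := by
      rcases hx with ⟨rfl, rfl⟩ | ⟨rfl, rfl⟩ <;>
        simp [hm₁, tail, head, NExp.eval, Memory.setNat, hF5.symm]
    have h2 : (Program.setReal A y (.plus (.cell A x) (.cell 2 (.reg 6)))).run m₁
        = m₁.setReal A b (m.real A a + ω s(a, b)) := by
      simp only [Program.run, NExp.eval, RExp.eval, hxy, ha, hb]
      simp only [hm₁, Memory.setNat, hw]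
    rw [Program.run_seq, h1, h2]
    intro v
    by_cases hv : v = b
    · subst hv
      rw [if_neg h.1] at hfa
      simp only [Memory.value, Memory.setReal, hm₁, Memory.setNat, Function.update_self, relax,
        one_ne_zero, if_false, ← hfa, ← hfb]
      split_ifs with h0
      · simp
      · rw [min_eq_right]
        · simp
        · have : m.real A a + ω s(a, v) < m.real A v := by
            by_contra hc
            exact h.2 ⟨h0, hc⟩
          exact_mod_cast this.le
    · have hv' : (v : ℕ) ≠ b := fun h => hv (Fin.ext h)
      rw [relax, Function.update_of_ne hv, ← hf v]
      simp [Memory.value, Memory.setReal, hm₁, Memory.setNat, hv']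
  · rw [Program.run_branch_of_not_holds fun h' => h ((htest _ rfl).1 h')]
    intro v
    by_cases hv : v = b
    · subst hv
      simp only [Program.run, relax, Function.update_self]
      rw [hf v, min_eq_left]
      by_cases h0 : m.nat F a = 0
      · rw [if_pos h0] at hfa
        simp [← hfa]
      · rw [if_neg h0] at hfa
        have h3 : m.nat F v ≠ 0 ∧ ¬ m.real A a + ω s(a, v) < m.real A v := by
          by_contra hc
          exact h ⟨h0, hc⟩
        rw [if_neg h3.1] at hfb
        rw [← hfa, ← hfb]
        exact_mod_cast not_lt.1 h3.2
    · rw [relax, Function.update_of_ne hv]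
      exact hf v

/-- One sweep: relaxation of all darts in the order of their tails, and of all reversed darts in
the reverse order. -/
def sweep (F A : ℕ) : Program :=
  .seq (forUp (visit (relaxDart F A tail head))) (forDown 0 (visit (relaxDart F A head tail)))

lemma safe_relaxDart {F A : ℕ} (hF : F ∉ [4, 5, 6, 8]) (hA : A ≠ 2) (x y : NExp) :
    (relaxDart F A x y).Safe :=
  ⟨by simp [relaxDart, Program.regs], by simpa [relaxDart, Program.nats] using hF,
    by simpa [relaxDart, Program.reals] using hA.symm⟩

lemma runs_sweep {F A : ℕ} (hF : F ∉ [4, 5, 6, 8]) (hA : A ≠ 2) {m : Memory}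
    (hm : HoldsGraph ω adj K L m) (hnd : L.Nodup) (hmem : ∀ v, v ∈ L) {f : Fin n → EReal}
    (hf : ∀ v : Fin n, m.value F A v = f v) :
    Runs (sweep F A) m (132 * ∑ v, (adj v).length + 32 * n + 10)
      fun m' => ∀ v : Fin n, m'.value F A v = relaxAll ω f (sweepEdges adj L) v := by
  have hreg : ∀ (m : Memory) r k v, (m.setReg r k).value F A v = m.value F A v :=
    fun _ _ _ _ => rfl
  refine Runs.seq (runs_forUp_visit hm (safe_relaxDart hF hA _ _) hnd hmem
    (fun E m' => ∃ g : Fin n → EReal, (∀ v : Fin n, m'.value F A v = g v) ∧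
      relaxAll ω g E = relaxAll ω f (arcs adj L)) 60 (fun E m' r k _ h => by simpa [hreg] using h)
      ⟨f, hf, rfl⟩ ?_)
    (T₂ := 66 * ∑ v, (adj v).length + 16 * n + 5) ?_ (by omega)
  · rintro v u E m' - - h5 h6 hw ⟨g, hg, hE⟩
    refine (runs_relaxDart hF (.inl ⟨rfl, rfl⟩) h5 h6 hw hg).weaken le_rfl ?_
    exact fun m'' _ h => ⟨_, h, hE⟩
  · rintro m₁ ha ⟨g₁, hg₁, he⟩
    obtain rfl : g₁ = relaxAll ω f (arcs adj L) := he
    have hm₁ : HoldsGraph ω adj K L m₁ := hm.of_agree ha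
      (by simp [forUp, visit, forDarts, relaxDart, Program.regs])
      (by simpa [forUp, visit, forDarts, relaxDart, Program.nats] using hF)
      (by simpa [forUp, visit, forDarts, relaxDart, Program.reals] using hA.symm)
    refine (runs_forDown_visit hm₁ (safe_relaxDart hF hA _ _) hnd hmem
      (fun E m' => ∃ g : Fin n → EReal, (∀ v : Fin n, m'.value F A v = g v) ∧
        relaxAll ω g (E.map Prod.swap) = relaxAll ω f (sweepEdges adj L)) 60
      (fun E m' r k _ h => by simpa [hreg] using h) ⟨_, hg₁, ?_⟩ ?_).weaken le_rfl ?_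
    · rw [← relaxAll_append]
      congr 1
      simp [sweepEdges, arcs, List.map_flatMap, Function.comp_def]
    · rintro v u E m' - - h5 h6 hw ⟨g, hg, hE⟩
      refine (runs_relaxDart (a := u) (b := v) hF (.inr ⟨rfl, rfl⟩) h6 h5
        (by rw [hw, Sym2.eq_swap]) hg).weaken le_rfl ?_
      exact fun m'' _ h => ⟨_, h, hE⟩
    · rintro m' - ⟨g, hg, hE⟩ v
      rw [hg, ← hE]
      rfl

/-! ### Predecessors -/

/-- Record the head of the current dart in array `P` if its tail is reached through it. -/
def recordPred (A P : ℕ) : Program :=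
  .branch (.conj (.neg (.realLt (.cell A tail) (.plus (.cell A head) (.cell 2 (.reg 6)))))
      (.neg (.realLt (.plus (.cell A head) (.cell 2 (.reg 6))) (.cell A tail))))
    (.setNat P tail head) .skip

/-- Array `P` holds a predecessor of every vertex that has one with respect to the distances in
array `A`. -/
def HoldsPreds (ω : Sym2 (Fin n) → ℝ) (adj : Fin n → List (Fin n)) (A P : ℕ) (m : Memory) : Prop :=
  ∀ v u : Fin n, u ∈ adj v → m.real A v = m.real A u + ω s(v, u) →
    ∃ x : Fin n, m.nat P v = x ∧ x ∈ adj v ∧ m.real A v = m.real A x + ω s(v, x)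

lemma runs_recordPreds {A P : ℕ} (hP : P ∉ [4, 5, 6, 8]) {m : Memory}
    (hm : HoldsGraph ω adj K L m) (hnd : L.Nodup) (hmem : ∀ v, v ∈ L) :
    Runs (forUp (visit (recordPred A P))) m (46 * ∑ v, (adj v).length + 16 * n + 5)
      (HoldsPreds ω adj A P) := by
  have hsafe : (recordPred A P).Safe :=
    ⟨by simp [recordPred, Program.regs], by simpa [recordPred, Program.nats] using hP,
      by simp [recordPred, Program.reals]⟩
  refine (runs_forUp_visit hm hsafe hnd hmem (fun E m' => ∀ v u : Fin n, u ∈ adj v → (v, u) ∉ E →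
    m'.real A v = m'.real A u + ω s(v, u) → ∃ x : Fin n, m'.nat P v = x ∧ x ∈ adj v ∧
      m'.real A v = m'.real A x + ω s(v, x)) 40 (fun E m' r k _ h => h) ?_ ?_).weaken le_rfl ?_
  · intro v u hu hn
    exact absurd (List.mem_flatMap.2 ⟨v, hmem v, List.mem_map_of_mem hu⟩) hn
  · intro v u E m' hu _ h5 h6 hw hJ
    refine Runs.straight rfl (by simp [recordPred, tail, head, Program.time, Test.cost, NExp.cost,
      RExp.cost]) ?_
    have ht : tail.eval m' = v := h5
    have hh : head.eval m' = u := h6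
    have htest : ∀ t : Test,
        t = (Test.conj (.neg (.realLt (.cell A tail) (.plus (.cell A head) (.cell 2 (.reg 6)))))
          (.neg (.realLt (.plus (.cell A head) (.cell 2 (.reg 6))) (.cell A tail)))) →
        (t.Holds m' ↔ m'.real A v = m'.real A u + ω s(v, u)) := by
      rintro _ rfl
      simp only [Test.Holds, NExp.eval, RExp.eval, ht, hh, hw, not_lt]
      exact ⟨fun h => le_antisymm h.2 h.1, fun h => ⟨h.ge, h.le⟩⟩
    rw [recordPred]
    by_cases h : m'.real A v = m'.real A u + ω s(v, u)
    · rw [Program.run_branch_of_holds ((htest _ rfl).2 h)]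
      simp only [Program.run, ht, hh, Memory.setNat, Function.update_self]
      intro v' u' hu' hn he
      by_cases hv : v' = v
      · subst hv
        exact ⟨u, by simp, hu, h⟩
      · have hv' : (v' : ℕ) ≠ v := fun h => hv (Fin.ext h)
        rw [Function.update_of_ne hv']
        exact hJ v' u' hu' (by simp [hn, hv]) he
    · rw [Program.run_branch_of_not_holds fun h' => h ((htest _ rfl).1 h')]
      intro v' u' hu' hn he
      by_cases hvu : v' = v ∧ u' = u
      · obtain ⟨rfl, rfl⟩ := hvu
        exact absurd he h
      · exact hJ v' u' hu' (by simpa [hn] using hvu) he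
  · intro m' _ h v u hu he
    exact h v u hu (by simp) he

end Passes

/-! ### Beer distances as distances from the beer stores -/

section Distances

variable {n : ℕ} {G : SimpleGraph (Fin n)} {ω : Sym2 (Fin n) → ℝ} {B : Finset (Fin n)} {s : Fin n}

/-- `D v` is the minimum weight of the walks from `s` to `v` with property `P`, and `⊤` if there
are none. -/
def IsMinWeight (ω : Sym2 (Fin n) → ℝ) (s : Fin n) (P : ∀ v, G.Walk s v → Prop)
    (D : Fin n → EReal) : Prop :=
  ∀ v, (∀ p, P v p → D v ≤ weight ω p) ∧ (D v = ⊤ ∨ ∃ p, P v p ∧ D v = weight ω p)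

/-- Every value after a sweep is an initial value plus the weight of a walk. -/
lemma exists_eq_add_of_relaxAll {adj : Fin n → List (Fin n)} (hadj : ∀ u v, u ∈ adj v ↔ G.Adj v u)
    (L : List (Fin n)) (f : Fin n → EReal) (v : Fin n) :
    ∃ (x : Fin n) (p : G.Walk x v),
      relaxAll ω f (sweepEdges adj L) v = f x + (weight ω p : EReal) := by
  refine exists_walk_of_relaxAll (fun e he => ?_) f v
  simp only [sweepEdges, List.mem_append, List.mem_flatMap, List.mem_map] at he
  rcases he with ⟨v, -, u, hu, rfl⟩ | ⟨v, -, u, hu, rfl⟩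
  · exact (hadj u v).1 hu
  · exact ((hadj u v).1 hu).symm

variable {adj : Fin n → List (Fin n)} {L : List (Fin n)}

/-- The sweep from the source alone yields the distances. -/
lemma isMinWeight_sweep_source (hadj : ∀ u v, u ∈ adj v ↔ G.Adj v u)
    (hle : ∀ (f : Fin n → EReal) (x v : Fin n) (p : G.Walk x v),
      relaxAll ω f (sweepEdges adj L) v ≤ f x + (weight ω p : EReal)) :
    IsMinWeight (G := G) ω s (fun _ _ => True)
      (relaxAll ω (fun v => if v = s then 0 else ⊤) (sweepEdges adj L)) := by
  intro v
  refine ⟨fun p _ => by simpa using hle (fun v => if v = s then 0 else ⊤) s v p, ?_⟩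
  obtain ⟨x, p, hp⟩ := exists_eq_add_of_relaxAll (ω := ω) hadj L
    (fun v => if v = s then 0 else ⊤) v
  by_cases hx : x = s
  · subst hx
    exact .inr ⟨p, trivial, by simpa using hp⟩
  · left
    rw [hp, if_neg hx, EReal.top_add_coe]

/-- The sweep from the beer stores, each starting with its distance from the source, yields the
beer distances: a beer path is a path to a beer store followed by a path from there. -/
lemma isMinWeight_sweep_beer (hadj : ∀ u v, u ∈ adj v ↔ G.Adj v u)
    (hle : ∀ (f : Fin n → EReal) (x v : Fin n) (p : G.Walk x v),
      relaxAll ω f (sweepEdges adj L) v ≤ f x + (weight ω p : EReal))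
    {D : Fin n → EReal} (hD : IsMinWeight (G := G) ω s (fun _ _ => True) D) :
    IsMinWeight (G := G) ω s (fun _ p => IsBeerPath B p)
      (relaxAll ω (fun v => if v ∈ B then D v else ⊤) (sweepEdges adj L)) := by
  intro v
  constructor
  · rintro p ⟨b, hb, hbp⟩
    have h1 := hle (fun v => if v ∈ B then D v else ⊤) b v (p.dropUntil b hbp)
    rw [if_pos hb] at h1
    refine h1.trans ?_
    have hw : weight ω p = weight ω (p.takeUntil b hbp) + weight ω (p.dropUntil b hbp) := by
      rw [← weight_append, p.take_spec]
    rw [hw, EReal.coe_add]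
    exact add_le_add ((hD b).1 _ trivial) le_rfl
  · obtain ⟨x, q, hq⟩ := exists_eq_add_of_relaxAll (ω := ω) hadj L
      (fun v => if v ∈ B then D v else ⊤) v
    by_cases hx : x ∈ B
    · rw [if_pos hx] at hq
      rcases (hD x).2 with h | ⟨p, -, hp⟩
      · left
        rw [hq, h, EReal.top_add_coe]
      · right
        refine ⟨p.append q, ⟨x, hx, ?_⟩, by rw [hq, hp, weight_append, EReal.coe_add]⟩
        rw [SimpleGraph.Walk.mem_support_append_iff]
        exact .inl p.end_mem_support
    · left
      rw [hq, if_neg hx, EReal.top_add_coe]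

lemma IsMinWeight.eq_beerDist {D : Fin n → EReal}
    (hD : IsMinWeight (G := G) ω s (fun _ p => IsBeerPath B p) D) (v : Fin n) :
    D v = beerDist G ω B s v := by
  apply le_antisymm
  · exact le_iInf fun p => (hD v).1 p.1 p.2
  · rcases (hD v).2 with h | ⟨p, hp, h⟩
    · rw [h]
      exact le_top
    · rw [h]
      exact iInf_le (fun p : {p : G.Walk s v // IsBeerPath B p} => (weight ω p.1 : EReal)) ⟨p, hp⟩

lemma triangle_of_generalizedTriangleInequality (hG : GeneralizedTriangleInequality G ω)
    {a b v : Fin n} (ha : G.Adj v a) (hb : G.Adj v b) (hab : G.Adj a b) :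
    ω s(a, b) ≤ ω s(a, v) + ω s(v, b) := by
  have h1 : dist G ω a b ≤ _ := iInf_le _ (SimpleGraph.Walk.cons ha.symm (.cons hb .nil))
  rw [hG a b hab] at h1
  simpa [weight] using EReal.coe_le_coe_iff.1 h1

end Distances

/-! ### The preprocessing -/

section Prep

variable {n : ℕ} {G : SimpleGraph (Fin n)} {ω : Sym2 (Fin n) → ℝ} {B : Finset (Fin n)} {s : Fin n}

/-- Mark the source as reached at distance zero. -/
def startSource : Program :=
  .seq (.setNat 9 (.reg 2) (.const 1)) (.setReal 3 (.reg 2) .zero)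

lemma runs_startSource {m : Memory} (hs : m.reg 2 = s) (h9 : ∀ v, m.nat 9 v = 0) :
    Runs startSource m 10
      fun m' => ∀ v : Fin n, m'.value 9 3 v = if v = s then 0 else ⊤ := by
  refine Runs.straight rfl (by decide) fun v => ?_
  by_cases hv : v = s
  · subst hv
    simp [startSource, Program.run, Memory.value, Memory.setNat, Memory.setReal, NExp.eval, hs,
      RExp.eval]
  · have hv' : (v : ℕ) ≠ s := fun h => hv (Fin.ext h)
    simp [startSource, Program.run, Memory.value, Memory.setNat, Memory.setReal, NExp.eval, hs,
      hv, hv', h9]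

/-- Start the second sweep from the beer stores with their distances. -/
def startBeer : Program :=
  forUp (.branch (.natEq (.cell 2 (.reg 4)) (.const 1))
    (.seq (.setNat 3 (.reg 4) (.cell 9 (.reg 4))) (.setReal 1 (.reg 4) (.cell 3 (.reg 4)))) .skip)

lemma runs_startBeer {m : Memory} (h₀ : m.reg 0 = n) (hB : ∀ v : Fin n, m.nat 2 v = 1 ↔ v ∈ B)
    (h3 : ∀ v, m.nat 3 v = 0) :
    Runs startBeer m (30 * n + 5)
      fun m' => ∀ v : Fin n, m'.value 3 1 v = if v ∈ B then m.value 9 3 v else ⊤ := by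
  refine (runs_forUp (fun i m' => ∀ v : Fin n, m'.value 3 1 v
    = if (v : ℕ) < i ∧ v ∈ B then m.value 9 3 v else ⊤) (fun _ => 24) (by decide) (by decide)
    (fun i m' k h => h) (by simp [Memory.value, h3]) ?_).weaken (by simp [h₀]; omega) ?_
  · intro i m' hi h4 ha hJ
    rw [h₀] at hi
    refine Runs.straight rfl (by decide) ?_
    have e2 : m'.nat 2 = m.nat 2 := ha.nat 2 (by decide)
    have htest : (Test.natEq (.cell 2 (.reg 4)) (.const 1)).Holds m' ↔ (⟨i, hi⟩ : Fin n) ∈ B := by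
      rw [← hB]
      simp [Test.Holds, NExp.eval, h4, e2]
    by_cases hb : (⟨i, hi⟩ : Fin n) ∈ B
    · rw [Program.run_branch_of_holds (htest.2 hb)]
      intro v
      by_cases hv : v = ⟨i, hi⟩
      · subst hv
        simp [Program.run, Memory.value, Memory.setNat, Memory.setReal, NExp.eval, RExp.eval, h4,
          hb, ha.nat 9 (by decide), ha.real 3 (by decide)]
      · have hv' : (v : ℕ) ≠ i := fun h => hv (Fin.ext h)
        have := hJ v
        simp only [Program.run, Memory.value, Memory.setNat, Memory.setReal, NExp.eval, RExp.eval,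
          h4, Function.update_self, Function.update_of_ne hv'] at this ⊢
        rw [this]
        congr 2
        simp only [eq_iff_iff]
        omega
    · rw [Program.run_branch_of_not_holds fun h => hb (htest.1 h)]
      intro v
      refine (hJ v).trans ?_
      by_cases hv : v = ⟨i, hi⟩
      · subst hv
        simp [hb]
      · have hv' : (v : ℕ) ≠ i := fun h => hv (Fin.ext h)
        congr 2
        simp only [eq_iff_iff]
        omega
  · intro m' _ h v
    rw [h v, h₀]
    simp

/-- The computation of the beer distances. -/
def prep : Program :=
  .seq build <| .seq initQueue <| .seq peel <| .seq startSource <| .seq (sweep 9 3) <|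
  .seq startBeer <| .seq (sweep 3 1) <|
  .seq (forUp (visit (recordPred 3 10))) (forUp (visit (recordPred 1 11)))

/-- What the memory holds after the preprocessing: the source, the marks of the beer stores, the
distances, the beer distances, and predecessors with respect to both. -/
structure Prepared (G : SimpleGraph (Fin n)) (ω : Sym2 (Fin n) → ℝ) (B : Finset (Fin n))
    (s : Fin n) (adj : Fin n → List (Fin n)) (m : Memory) : Prop where
  source : m.reg 2 = s
  beer : ∀ v : Fin n, m.nat 2 v = 1 ↔ v ∈ B
  dist : IsMinWeight (G := G) ω s (fun _ _ => True) fun v => m.value 9 3 v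
  beerDist : IsMinWeight (G := G) ω s (fun _ p => IsBeerPath B p) fun v => m.value 3 1 v
  preds : HoldsPreds ω adj 3 10 m
  beerPreds : HoldsPreds ω adj 1 11 m

/-- The preprocessing takes linear time: the graph has at most `2 * n` edges, and every phase takes
time proportional to the numbers of vertices and edges. -/
lemma runs_prep (hG : IsMaximalOuterplanar G) (hω : ∀ e ∈ G.edgeSet, 0 < ω e)
    (htri : GeneralizedTriangleInequality G ω) {l : List (Fin n × Fin n)} (hl : IsEdgeList G l) :
    Runs prep (inputMemory ω B s l) (3000 * n) (Prepared G ω B s (adjOf l)) := by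
  classical
  obtain ⟨θ, hθ, hn, hsat⟩ := exists_order_of_isMaximalOuterplanar hG
  set adj := adjOf l with hadj_def
  have hadj : ∀ u v, u ∈ adj v ↔ G.Adj v u := by
    intro u v
    rw [hadj_def, mem_adjOf, hl.2, SimpleGraph.mem_edgeSet]
  have hnd : ∀ v, (adj v).Nodup := nodup_adjOf hl.1 fun e he =>
    ((SimpleGraph.mem_edgeSet G).1 ((hl.2 _).1 (List.mem_map_of_mem he))).ne
  have hsum : ∑ v, (adj v).length ≤ 4 * n := by
    have h1 := hn.sum_degree_le hθ Finset.univ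
    rw [Finset.card_univ, Fintype.card_fin] at h1
    refine le_of_eq_of_le (Finset.sum_congr rfl fun v _ => ?_) h1
    rw [← List.toFinset_card_of_nodup (hnd v)]
    congr 1
    ext u
    simp [hadj]
  have hlen : ∑ v, (adj v).length = 2 * l.length := sum_length_adjOf l
  have hn0 : 0 < n := s.pos
  set m₀ := inputMemory ω B s l with hm₀
  -- the bounds `T₂` below leave a generous margin for the phases that remain
  refine Runs.seq (T₁ := 66 * l.length + 5) (T₂ := 2800 * n) (runs_build (ω := ω) rfl ?_ ?_) ?_
    (by omega)
  · intro i hi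
    simp [hm₀, inputMemory, List.getElem?_eq_getElem hi]
  · intro v
    simp [hm₀, inputMemory, Darts]
  intro m₁ a₁ hbuilt
  refine Runs.seq (T₁ := 30 * n + 10) (T₂ := 2700 * n)
    (runs_initQueue (deg := fun v => (adj v).length) (a₁.reg 0 (by decide)) fun v => (hbuilt v).2)
    ?_ (by omega)
  rintro m₂ a₂ ⟨L, hL, hLnd, hLmem⟩
  refine Runs.seq (T₁ := 36 * ∑ v, (adj v).length + 20 * n + 10) (T₂ := 2400 * n)
    (runs_peel (ω := ω) (adj := adj) (K := m₁.reg 8) (deg := fun v => (adj v).length) hθ hn hsat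
      hadj hnd (fun v => ?_) (fun v => ?_) (fun _ => rfl) hL hLnd hLmem) ?_ (by omega)
  · rw [a₂.nat 4 (by decide), a₂.nat 5 (by decide), a₂.nat 6 (by decide), a₂.real 2 (by decide)]
    exact (hbuilt v).1
  · rw [a₂.nat 7 (by decide)]
    exact (hbuilt v).2
  rintro m₃ a₃ ⟨L, hL, hnd', hmem, helim⟩
  have hg₃ : HoldsGraph ω adj (m₁.reg 8) L m₃ := by
    refine ⟨?_, fun v => ?_, hL⟩
    · rw [a₃.reg 0 (by decide), a₂.reg 0 (by decide), a₁.reg 0 (by decide)]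
      rfl
    · rw [a₃.nat 4 (by decide), a₃.nat 5 (by decide), a₃.nat 6 (by decide), a₃.real 2 (by decide),
        a₂.nat 4 (by decide), a₂.nat 5 (by decide), a₂.nat 6 (by decide), a₂.real 2 (by decide)]
      exact (hbuilt v).1
  have hs₃ : m₃.reg 2 = s := by
    rw [a₃.reg 2 (by decide), a₂.reg 2 (by decide), a₁.reg 2 (by decide)]
    rfl
  -- one sweep computes distances, whatever the initial values are
  have hle : ∀ (f : Fin n → EReal) (x v : Fin n) (p : G.Walk x v),
      relaxAll ω f (sweepEdges adj L) v ≤ f x + (weight ω p : EReal) := fun f x v p =>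
    relaxAll_sweepEdges_le hadj (fun u v huv => (hω _ huv).le)
      (fun a b v ha hb hab => triangle_of_generalizedTriangleInequality htri ha hb hab) helim hmem
      f p
  refine Runs.seq (T₁ := 10) (T₂ := 2300 * n) (runs_startSource hs₃ fun v => ?_) ?_ (by omega)
  · rw [a₃.nat 9 (by decide), a₂.nat 9 (by decide), a₁.nat 9 (by decide)]
    rfl
  intro m₄ a₄ hv₄
  have hg₄ := hg₃.of_agree a₄ (by decide) (by decide) (by decide)
  refine Runs.seq (T₁ := 132 * ∑ v, (adj v).length + 32 * n + 10) (T₂ := 1600 * n)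
    (runs_sweep (by decide) (by decide) hg₄ hnd' hmem hv₄) ?_ (by omega)
  intro m₅ a₅ hv₅
  have hg₅ := hg₄.of_agree a₅ (by decide) (by decide) (by decide)
  have hD₀ := isMinWeight_sweep_source (s := s) hadj hle
  have hB₅ : ∀ v : Fin n, m₅.nat 2 v = 1 ↔ v ∈ B := by
    intro v
    rw [a₅.nat 2 (by decide), a₄.nat 2 (by decide), a₃.nat 2 (by decide), a₂.nat 2 (by decide),
      a₁.nat 2 (by decide)]
    simp [hm₀, inputMemory, Fin.val_inj]
  refine Runs.seq (T₁ := 30 * n + 5) (T₂ := 1500 * n)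
    (runs_startBeer hg₅.size hB₅ fun v => ?_) ?_ (by omega)
  · rw [a₅.nat 3 (by decide), a₄.nat 3 (by decide), a₃.nat 3 (by decide), a₂.nat 3 (by decide),
      a₁.nat 3 (by decide)]
    rfl
  intro m₆ a₆ hv₆
  have hg₆ := hg₅.of_agree a₆ (by decide) (by decide) (by decide)
  refine Runs.seq (T₁ := 132 * ∑ v, (adj v).length + 32 * n + 10) (T₂ := 900 * n)
    (runs_sweep (by decide) (by decide) hg₆ hnd' hmem hv₆) ?_ (by omega)
  intro m₇ a₇ hv₇
  have hg₇ := hg₆.of_agree a₇ (by decide) (by decide) (by decide)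
  refine Runs.seq (T₁ := 46 * ∑ v, (adj v).length + 16 * n + 5)
    (T₂ := 46 * ∑ v, (adj v).length + 16 * n + 5)
    (runs_recordPreds (A := 3) (P := 10) (by decide) hg₇ hnd' hmem) ?_ (by omega)
  intro m₈ a₈ hp₈
  have hg₈ := hg₇.of_agree a₈ (by decide) (by decide) (by decide)
  refine (runs_recordPreds (A := 1) (P := 11) (by decide) hg₈ hnd' hmem).weaken le_rfl ?_
  intro m₉ a₉ hp₉
  refine ⟨?_, ?_, ?_, ?_, ?_, hp₉⟩
  · rw [a₉.reg 2 (by decide), a₈.reg 2 (by decide), a₇.reg 2 (by decide), a₆.reg 2 (by decide),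
      a₅.reg 2 (by decide), a₄.reg 2 (by decide), hs₃]
  · intro v
    rw [a₉.nat 2 (by decide), a₈.nat 2 (by decide), a₇.nat 2 (by decide), a₆.nat 2 (by decide)]
    exact hB₅ v
  · convert hD₀ using 1
    ext v
    rw [← hv₅ v]
    simp only [Memory.value]
    rw [a₉.nat 9 (by decide), a₈.nat 9 (by decide), a₇.nat 9 (by decide), a₆.nat 9 (by decide),
      a₉.real 3 (by decide), a₈.real 3 (by decide), a₇.real 3 (by decide), a₆.real 3 (by decide)]
  · convert isMinWeight_sweep_beer (B := B) hadj hle hD₀ using 1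
    ext v
    simp only [hv₅] at hv₇
    rw [← hv₇ v]
    simp only [Memory.value]
    rw [a₉.nat 3 (by decide), a₈.nat 3 (by decide), a₉.real 1 (by decide), a₈.real 1 (by decide)]
  · intro v u hu
    rw [a₉.nat 10 (by decide), a₉.real 3 (by decide)]
    exact hp₈ v u hu

end Prep

/-! ### Queries -/

section Query

variable {n : ℕ} {G : SimpleGraph (Fin n)} {ω : Sym2 (Fin n) → ℝ} {B : Finset (Fin n)} {s : Fin n}

/-- `d v` is the weight of a lightest walk from `s` to `v` with property `P`. -/
def IsAttainedMin (ω : Sym2 (Fin n) → ℝ) (s : Fin n) (P : ∀ v, G.Walk s v → Prop)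
    (d : Fin n → ℝ) : Prop :=
  ∀ v, (∀ p, P v p → d v ≤ weight ω p) ∧ ∃ p, P v p ∧ d v = weight ω p

/-- If there are walks with property `P` to all vertices, no flag of infinity is set, and the real
cells hold the minima. -/
lemma IsMinWeight.isAttainedMin {P : ∀ v, G.Walk s v → Prop} {F A : ℕ} {m : Memory}
    (h : IsMinWeight ω s P fun v => m.value F A v) (hP : ∀ v, ∃ p, P v p) :
    IsAttainedMin ω s P fun v => m.real A v := by
  intro v
  obtain ⟨p₀, hp₀⟩ := hP v
  have htop : m.value F A v ≠ ⊤ := ne_top_of_le_ne_top (EReal.coe_ne_top _) ((h v).1 p₀ hp₀)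
  have hval : m.value F A v = (m.real A v : EReal) := by
    rw [Memory.value] at htop ⊢
    split_ifs at htop ⊢
    · exact absurd rfl htop
    · rfl
  have h1 := h v
  simp only [hval] at h1
  refine ⟨fun p hp => by exact_mod_cast h1.1 p hp, ?_⟩
  rcases h1.2 with h2 | ⟨p, hp, h2⟩
  · exact absurd h2 (EReal.coe_ne_top _)
  · exact ⟨p, hp, by exact_mod_cast h2⟩

lemma IsAttainedMin.exists_pred {d : Fin n → ℝ}
    (hd : IsAttainedMin (G := G) ω s (fun _ _ => True) d)
    {v : Fin n} (hv : v ≠ s) : ∃ u, G.Adj v u ∧ d v = d u + ω s(v, u) := by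
  obtain ⟨p, -, hp⟩ := (hd v).2
  induction p using SimpleGraph.Walk.concatRec with
  | Hnil => exact absurd rfl hv
  | @Hconcat s u v q h _ =>
    obtain ⟨p', -, hp'⟩ := (hd u).2
    have h1 := (hd u).1 q trivial
    have h2 := (hd v).1 (p'.concat h) trivial
    rw [weight_concat] at hp h2
    refine ⟨u, h.symm, ?_⟩
    rw [Sym2.eq_swap (a := v)]
    linarith

/-- Unless `v` is a beer store whose distance and beer distance agree, a shortest beer path to `v`
without its last edge is a shortest beer path. -/
lemma IsAttainedMin.exists_pred_beer {d d' : Fin n → ℝ}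
    (hd : IsAttainedMin (G := G) ω s (fun _ _ => True) d)
    (hd' : IsAttainedMin (G := G) ω s (fun _ p => IsBeerPath B p) d')
    {v : Fin n} (hv : ¬ (v ∈ B ∧ d' v = d v)) : ∃ u, G.Adj v u ∧ d' v = d' u + ω s(v, u) := by
  have hstore : v ∈ B → d' v ≤ d v := by
    intro hvB
    obtain ⟨p, -, hp⟩ := (hd v).2
    rw [hp]
    exact (hd' v).1 p ⟨v, hvB, p.end_mem_support⟩
  obtain ⟨p, hb, hp⟩ := (hd' v).2
  have hle := (hd v).1 p trivial
  have hvB : v ∉ B := fun h => hv ⟨h, le_antisymm (hstore h) (hp ▸ hle)⟩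
  clear hstore hle hv
  induction p using SimpleGraph.Walk.concatRec with
  | Hnil =>
    obtain ⟨b, hb, hbp⟩ := hb
    simp only [SimpleGraph.Walk.support_nil, List.mem_singleton] at hbp
    exact absurd (hbp ▸ hb) hvB
  | @Hconcat s u v q h _ =>
    obtain ⟨p', hb', hp'⟩ := (hd' u).2
    have hq : IsBeerPath B q := by
      obtain ⟨b, hb, hbp⟩ := hb
      rw [SimpleGraph.Walk.support_concat, List.mem_append,
        List.mem_singleton] at hbp
      rcases hbp with h | rfl
      · exact ⟨b, hb, h⟩
      · exact absurd hb hvB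
    have h1 := (hd' u).1 q hq
    have h2 := (hd' v).1 (p'.concat h) (by
      obtain ⟨b, hb, hbp⟩ := hb'
      exact ⟨b, hb, by simp [SimpleGraph.Walk.support_concat, hbp]⟩)
    rw [weight_concat] at hp h2
    refine ⟨u, h.symm, ?_⟩
    rw [Sym2.eq_swap (a := v)]
    linarith

lemma support_tail_concat {u v w : Fin n} (p : G.Walk u v) (h : G.Adj v w) :
    (p.concat h).support.tail = p.support.tail ++ [w] := by
  rw [SimpleGraph.Walk.support_concat, List.tail_append_of_ne_nil p.support_ne_nil]

/-- Push the current vertex, in register `5`, on the stack, and go to its predecessor. -/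
def pushPred (P : ℕ) : Program :=
  .seq (.setNat 12 (.reg 6) (.reg 5))
    (.seq (.setReg 6 (.succ (.reg 6))) (.setReg 5 (.cell P (.reg 5))))

/-- Follow the predecessors of beer paths up to a beer store on a shortest path. -/
def traceBeer : Program :=
  .loop (.neg (.conj (.natEq (.cell 2 (.reg 5)) (.const 1))
    (.conj (.neg (.realLt (.cell 1 (.reg 5)) (.cell 3 (.reg 5))))
      (.neg (.realLt (.cell 3 (.reg 5)) (.cell 1 (.reg 5))))))) (pushPred 11)

/-- Follow the predecessors of paths up to the source. -/
def tracePlain : Program :=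
  .loop (.neg (.natEq (.reg 5) (.reg 2))) (pushPred 10)

/-- Output the stack from the top to the bottom. -/
def popAll : Program :=
  .loop (.natLt (.const 0) (.reg 6))
    (.seq (.setReg 6 (.pred (.reg 6))) (.emit (.cell 12 (.reg 6))))

/-- Report a shortest beer path to the vertex in register `3`. -/
def query : Program :=
  .seq (.setReg 5 (.reg 3)) <| .seq (.setReg 6 (.const 0)) <| .seq traceBeer <|
  .seq tracePlain <| .seq (.emit (.reg 5)) popAll

/-- The state of a query: the current vertex is `v`, and the stack is `st`. -/
structure Tracing (m₀ : Memory) (v : Fin n) (st : List (Fin n)) (m : Memory) : Prop where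
  agree : query.Agree m₀ m
  vertex : m.reg 5 = v
  size : m.reg 6 = st.length
  stack : ∀ i (h : i < st.length), m.nat 12 i = (st[i] : ℕ)
  out : m.out = []

lemma runs_pushPred {P : ℕ} (hP : P ≠ 12) {m₀ m : Memory} {v x : Fin n} {st : List (Fin n)}
    (h : Tracing m₀ v st m) (hx : m.nat P v = x) :
    Runs (pushPred P) m 9 (Tracing m₀ x (st ++ [v])) := by
  refine ⟨_, _, .seq (.setNat _ _ _ _) (.seq (.setReg _ _ _) (.setReg _ _ _)), le_of_eq rfl, ?_⟩
  refine ⟨h.agree.trans ⟨fun k hk => ?_, fun k hk => ?_, fun _ _ => rfl⟩, ?_, ?_, ?_, h.out⟩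
  · have h5 : k ≠ 5 := by
      rintro rfl
      exact hk (by decide)
    have h6 : k ≠ 6 := by
      rintro rfl
      exact hk (by decide)
    simp [Memory.setReg, Memory.setNat, h5, h6]
  · have h12 : k ≠ 12 := by
      rintro rfl
      exact hk (by decide)
    simp [Memory.setReg, Memory.setNat, h12]
  · simp [Memory.setReg, Memory.setNat, NExp.eval, h.vertex, hP, hx]
  · simp [Memory.setReg, Memory.setNat, NExp.eval, h.size]
  · intro i hi
    simp only [Memory.setReg, Memory.setNat, NExp.eval, Function.update_self, h.size, h.vertex]
    by_cases hi' : i < st.length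
    · rw [Function.update_of_ne (by omega), List.getElem_append_left hi']
      exact h.stack i hi'
    · have : i = st.length := by
        simp at hi
        omega
      subst this
      simp

lemma wellFounded_of_real (d : Fin n → ℝ) : WellFounded fun u v : Fin n => d u < d v :=
  haveI : IsTrans (Fin n) fun u v => d u < d v := ⟨fun _ _ _ h h' => h.trans h'⟩
  haveI : Std.Irrefl fun u v : Fin n => d u < d v := ⟨fun _ => lt_irrefl _⟩
  Finite.wellFounded_of_trans_of_irrefl _

variable {adj : Fin n → List (Fin n)} {m₀ : Memory}

/-- The predecessors lead back to the source, since the distance drops in every step. -/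
lemma exists_runs_tracePlain (hadj : ∀ u v, u ∈ adj v ↔ G.Adj v u)
    (hω : ∀ e ∈ G.edgeSet, 0 < ω e) (hs : m₀.reg 2 = s) (hp : HoldsPreds ω adj 3 10 m₀)
    (hd : IsAttainedMin (G := G) ω s (fun _ _ => True) fun v => m₀.real 3 v) (v : Fin n) :
    ∃ p : G.Walk s v, weight ω p = m₀.real 3 v ∧ ∀ m st, Tracing m₀ v st m →
      Runs tracePlain m (13 * p.length + 4) (Tracing m₀ s (st ++ p.support.tail.reverse)) := by
  induction v using (wellFounded_of_real fun v : Fin n => m₀.real 3 v).induction with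
  | _ v ih =>
    by_cases hv : v = s
    · subst hv
      refine ⟨.nil, ?_, fun m st hm => Runs.loop_of_not_holds ?_ (by simp [Test.cost, NExp.cost])
        (by simpa using hm)⟩
      · obtain ⟨h1, p, -, h2⟩ := hd v
        have h3 := h1 .nil trivial
        have h4 := weight_nonneg hω p
        rw [weight_nil] at h3 ⊢
        linarith
      · simp [Test.Holds, NExp.eval, hm.vertex, hm.agree.reg 2 (by decide), hs]
    · obtain ⟨u, hu, hdu⟩ := hd.exists_pred hv
      obtain ⟨x, hx, hxadj, hdx⟩ := hp v u ((hadj u v).2 hu) hdu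
      have hvx := (hadj x v).1 hxadj
      obtain ⟨p, hpw, hrun⟩ := ih x (by linarith [hω s(v, x) hvx])
      refine ⟨p.concat hvx.symm, ?_, fun m st hm => ?_⟩
      · rw [weight_concat, hpw, hdx, Sym2.eq_swap]
      · refine Runs.loop_of_holds ?_ (runs_pushPred (by decide) hm (x := x) ?_)
          (fun m' hm' => ?_) (T₂ := 13 * p.length + 4) ?_
        · simpa [Test.Holds, NExp.eval, hm.vertex, hm.agree.reg 2 (by decide), hs, Fin.val_inj]
            using hv
        · rw [hm.agree.nat 10 (by decide), hx]
        · have := hrun m' _ hm'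
          rw [support_tail_concat]
          rw [List.reverse_append, List.reverse_singleton, ← List.append_assoc]
          exact this
        · rw [SimpleGraph.Walk.length_concat]
          simp only [Test.cost, NExp.cost]
          omega

/-- The beer predecessors lead back to a beer store on a path that is completed by a shortest path
from the source. -/
lemma exists_runs_traceBeer (hadj : ∀ u v, u ∈ adj v ↔ G.Adj v u)
    (hω : ∀ e ∈ G.edgeSet, 0 < ω e) (hB : ∀ v : Fin n, m₀.nat 2 v = 1 ↔ v ∈ B)
    (hp : HoldsPreds ω adj 1 11 m₀)
    (hd : IsAttainedMin (G := G) ω s (fun _ _ => True) fun v => m₀.real 3 v)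
    (hd' : IsAttainedMin (G := G) ω s (fun _ p => IsBeerPath B p) fun v => m₀.real 1 v)
    (v : Fin n) :
    ∃ x ∈ B, ∃ p : G.Walk x v, m₀.real 1 v = m₀.real 3 x + weight ω p ∧
      ∀ m st, Tracing m₀ v st m →
        Runs traceBeer m (40 * p.length + 30) (Tracing m₀ x (st ++ p.support.tail.reverse)) := by
  induction v using (wellFounded_of_real fun v : Fin n => m₀.real 1 v).induction with
  | _ v ih =>
    have htest : ∀ m st t, Tracing m₀ v st m → t = (Test.neg (.conj
        (.natEq (.cell 2 (.reg 5)) (.const 1))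
        (.conj (.neg (.realLt (.cell 1 (.reg 5)) (.cell 3 (.reg 5))))
          (.neg (.realLt (.cell 3 (.reg 5)) (.cell 1 (.reg 5))))))) →
        (t.Holds m ↔ ¬ (v ∈ B ∧ m₀.real 1 v = m₀.real 3 v)) := by
      rintro m st _ hm rfl
      simp only [Test.Holds, NExp.eval, RExp.eval, hm.vertex, hm.agree.nat 2 (by decide), hB,
        hm.agree.real 1 (by decide), hm.agree.real 3 (by decide), not_lt, le_antisymm_iff]
      tauto
    by_cases hv : v ∈ B ∧ m₀.real 1 v = m₀.real 3 v
    · exact ⟨v, hv.1, .nil, by simp [weight_nil, hv.2], fun m st hm =>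
        Runs.loop_of_not_holds (fun h => (htest m st _ hm rfl).1 h hv)
          (by simp [Test.cost, NExp.cost, RExp.cost]) (by simpa using hm)⟩
    · obtain ⟨u, hu, hdu⟩ := hd.exists_pred_beer hd' hv
      obtain ⟨y, hy, hyadj, hdy⟩ := hp v u ((hadj u v).2 hu) hdu
      have hvy := (hadj y v).1 hyadj
      obtain ⟨x, hx, p, hpw, hrun⟩ := ih y (by linarith [hω s(v, y) hvy])
      refine ⟨x, hx, p.concat hvy.symm, ?_, fun m st hm => ?_⟩
      · rw [weight_concat, hdy, hpw, Sym2.eq_swap, add_assoc]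
      · refine Runs.loop_of_holds ((htest m st _ hm rfl).2 hv)
          (runs_pushPred (by decide) hm (x := y) ?_) (fun m' hm' => ?_)
          (T₂ := 40 * p.length + 30) ?_
        · rw [hm.agree.nat 11 (by decide), hy]
        · have := hrun m' _ hm'
          rw [support_tail_concat]
          rw [List.reverse_append, List.reverse_singleton, ← List.append_assoc]
          exact this
        · rw [SimpleGraph.Walk.length_concat]
          simp only [Test.cost, NExp.cost, RExp.cost]
          omega

lemma runs_popAll {m : Memory} {st : List (Fin n)} (h6 : m.reg 6 = st.length)
    (h12 : ∀ i (h : i < st.length), m.nat 12 i = (st[i] : ℕ)) :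
    Runs popAll m (9 * st.length + 3) fun m' => m'.out = m.out ++ (st.reverse).map Fin.val := by
  induction st using List.reverseRecOn generalizing m with
  | nil =>
    exact Runs.loop_of_not_holds (by simp [Test.Holds, NExp.eval, h6])
      (by simp [Test.cost, NExp.cost]) (by simp)
  | append_singleton st a ih =>
    rw [List.length_append, List.length_singleton] at h6
    set m₁ := (m.setReg 6 st.length).emit a with hm₁
    refine Runs.loop_of_holds (by simp [Test.Holds, NExp.eval, h6]) (T₁ := 6)
      (T₂ := 9 * st.length + 3) (Q₁ := fun m' => m' = m₁) ?_ ?_ ?_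
    · refine Runs.straight rfl (by decide) ?_
      have := h12 st.length (by simp)
      simp only [List.getElem_concat_length] at this
      simp [Program.run, NExp.eval, h6, hm₁, Memory.setReg, this]
    · rintro _ rfl
      refine (ih (m := m₁) (by simp [hm₁, Memory.setReg, Memory.emit]) fun i hi => ?_).weaken le_rfl
        fun m' _ h => ?_
      · have := h12 i (by simp; omega)
        rw [List.getElem_append_left hi] at this
        exact this
      · rw [h]
        simp [hm₁, Memory.emit, Memory.setReg]
    · simp [Test.cost, NExp.cost]
      omega

/-- A query reports a shortest path to a beer store, followed by a shortest path from there. -/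
lemma runs_query (hadj : ∀ u v, u ∈ adj v ↔ G.Adj v u) (hω : ∀ e ∈ G.edgeSet, 0 < ω e)
    (hconn : ∀ v, G.Reachable s v) (hne : B.Nonempty) {m : Memory}
    (hm : Prepared G ω B s adj m) (v : Fin n) :
    ∃ p : G.Walk s v, IsShortestBeerPath ω B p ∧
      Runs query (m.ask v) (3000 * p.support.length) fun m' =>
        m'.out = p.support.map Fin.val := by
  obtain ⟨b, hb⟩ := hne
  have hd : IsAttainedMin (G := G) ω s (fun _ _ => True) fun v => m.real 3 v :=
    hm.dist.isAttainedMin fun v => ⟨(hconn v).some, trivial⟩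
  have hd' : IsAttainedMin (G := G) ω s (fun _ p => IsBeerPath B p) fun v => m.real 1 v :=
    hm.beerDist.isAttainedMin fun v =>
      ⟨(hconn b).some.append ((hconn b).symm.trans (hconn v)).some, b, hb, by
        rw [SimpleGraph.Walk.mem_support_append_iff]
        exact .inl (SimpleGraph.Walk.end_mem_support _)⟩
  obtain ⟨x, hx, q, hq, hrun⟩ := exists_runs_traceBeer (m₀ := m.ask v) hadj hω hm.beer
    hm.beerPreds hd hd' v
  obtain ⟨p, hp, hrun'⟩ := exists_runs_tracePlain (m₀ := m.ask v) hadj hω hm.source hm.preds hd x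
  have hsupp : (p.append q).support = s :: (p.support.tail ++ q.support.tail) := by
    rw [SimpleGraph.Walk.support_append, ← List.cons_append, p.cons_tail_support]
  have hlen : (p.append q).support.length = p.length + q.length + 1 := by
    rw [SimpleGraph.Walk.length_support, SimpleGraph.Walk.length_append]
  refine ⟨p.append q, ⟨⟨x, hx, ?_⟩, fun r hr => ?_⟩, ?_⟩
  · rw [SimpleGraph.Walk.mem_support_append_iff]
    exact .inl p.end_mem_support
  · rw [weight_append, hp, ← hq]
    exact (hd' v).1 r hr
  -- the bounds below leave a generous margin for the steps that remain
  set m₁ := ((m.ask v).setReg 5 v).setReg 6 0 with hm₁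
  have htrace : Tracing (m.ask v) v [] m₁ := by
    refine ⟨⟨fun k hk => ?_, fun _ _ => rfl, fun _ _ => rfl⟩, ?_, ?_, by simp, rfl⟩
    · have h5 : k ≠ 5 := by
        rintro rfl
        exact hk (by decide)
      have h6 : k ≠ 6 := by
        rintro rfl
        exact hk (by decide)
      simp [hm₁, Memory.setReg, h5, h6]
    · simp [hm₁, Memory.setReg]
    · simp [hm₁, Memory.setReg]
  refine Runs.seq (Q₁ := fun m' => m' = (m.ask v).setReg 5 v) (T₁ := 2)
    (T₂ := 2000 * (p.length + q.length + 1))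
    (Runs.setReg (by simp [NExp.eval, Memory.ask, Memory.setReg]) le_rfl) ?_ (by omega)
  rintro _ - rfl
  refine Runs.seq (Q₁ := fun m' => m' = m₁) (T₁ := 2)
    (T₂ := 1500 * (p.length + q.length + 1)) (Runs.setReg (by simp [NExp.eval, hm₁]) le_rfl) ?_
    (by omega)
  rintro _ - rfl
  refine Runs.seq (hrun _ _ htrace) (T₂ := 1000 * (p.length + q.length + 1)) ?_ (by omega)
  rintro m₂ - h₂
  refine Runs.seq (hrun' _ _ h₂) (T₂ := 500 * (p.length + q.length + 1)) ?_ (by omega)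
  rintro m₃ - h₃
  refine Runs.seq (Q₁ := fun m' => m' = m₃.emit s) (T₁ := 2)
    (T₂ := 400 * (p.length + q.length + 1))
    (Runs.straight rfl (by decide) (by simp [Program.run, NExp.eval, h₃.vertex])) ?_ (by omega)
  rintro _ - rfl
  refine (runs_popAll (m := m₃.emit s) h₃.size h₃.stack).weaken ?_ fun m' _ h => ?_
  · simp
    omega
  · rw [h, hsupp]
    simp [Memory.emit, h₃.out]

/-- Queries write only to scratch registers, to the stack and to the output. -/
lemma Prepared.of_afterQueries {m m' : Memory} (hm : Prepared G ω B s adj m)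
    (h : AfterQueries query n m m') : Prepared G ω B s adj m' := by
  induction h with
  | refl => exact hm
  | @tail m₁ m₂ _ h ih =>
    obtain ⟨v, -, t, he⟩ := h
    have ha := he.agree
    have e2 : m₂.nat 2 = m₁.nat 2 := ha.nat 2 (by decide)
    have e3 : m₂.nat 3 = m₁.nat 3 := ha.nat 3 (by decide)
    have e9 : m₂.nat 9 = m₁.nat 9 := ha.nat 9 (by decide)
    have e10 : m₂.nat 10 = m₁.nat 10 := ha.nat 10 (by decide)
    have e11 : m₂.nat 11 = m₁.nat 11 := ha.nat 11 (by decide)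
    have r1 : m₂.real 1 = m₁.real 1 := ha.real 1 (by decide)
    have r3 : m₂.real 3 = m₁.real 3 := ha.real 3 (by decide)
    have hs : m₂.reg 2 = m₁.reg 2 := ha.reg 2 (by decide)
    refine ⟨hs.trans ih.source, ?_, ?_, ?_, ?_, ?_⟩
    · rw [e2]
      exact ih.beer
    · simpa only [Memory.value, e9, r3] using ih.dist
    · simpa only [Memory.value, e3, r1] using ih.beerDist
    · simpa only [HoldsPreds, e10, r3] using ih.preds
    · simpa only [HoldsPreds, e11, r1] using ih.beerPreds

end Query

end Beer

theorem mainTheorem4 :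
    ∃ (prep query : Beer.Program) (C : ℕ),
      ∀ (n : ℕ) (G : SimpleGraph (Fin n)) (ω : Sym2 (Fin n) → ℝ) (B : Finset (Fin n)) (s : Fin n)
        (l : List (Fin n × Fin n)),
        Beer.IsMaximalOuterplanar G →
        (∀ e ∈ G.edgeSet, 0 < ω e) →
        Beer.GeneralizedTriangleInequality G ω →
        Beer.IsEdgeList G l →
        ∃ (t : ℕ) (m : Beer.Memory),
          Beer.Exec prep (Beer.inputMemory ω B s l) t m ∧
          t ≤ C * n ∧
          (∀ v : Fin n, m.result v = Beer.beerDist G ω B s v) ∧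
          (B.Nonempty → ∀ m' : Beer.Memory, Beer.AfterQueries query n m m' →
            ∀ v : Fin n, ∃ (t' : ℕ) (m'' : Beer.Memory) (p : G.Walk s v),
              Beer.Exec query (m'.ask v) t' m'' ∧
              Beer.IsShortestBeerPath ω B p ∧
              m''.out = p.support.map Fin.val ∧
              t' ≤ C * p.support.length) := by
  refine ⟨Beer.prep, Beer.query, 3000, fun n G ω B s l hG hω htri hl => ?_⟩
  obtain ⟨t, m, he, ht, hm⟩ := Beer.runs_prep (B := B) (s := s) hG hω htri hl
  refine ⟨t, m, he, ht, fun v => hm.beerDist.eq_beerDist v, fun hne m' hm' v => ?_⟩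
  obtain ⟨θ, hθ, -, hsat⟩ := Beer.exists_order_of_isMaximalOuterplanar hG
  have hadj : ∀ u v, u ∈ Beer.adjOf l v ↔ G.Adj v u := by
    intro u v
    rw [Beer.mem_adjOf, hl.2, SimpleGraph.mem_edgeSet]
  obtain ⟨p, hp, t', m'', he', ht', hout⟩ := Beer.runs_query hadj hω
    (fun v => hsat.reachable hθ s v) hne (hm.of_afterQueries hm') v
  exact ⟨t', m'', p, he', hp, hout, ht'⟩
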